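/- Setting. There are $Q$ users. User $q$ has $n_{T_q}$ transmit and $n_{R_q}\ge 1$ receive antennas, channels $H_{qr}\in\mathbb C^{n_{R_q}\times n_{T_r}}$ (from transmitter $r$ to receiver $q$), a noise covariance matrix $R_{n_q}\succ 0$, a circuitry power $\Psi_q>0$ and a maximum power $P_q\ge 0$. In the energy-efficiency game $\mathcal G_E$, user $q$ chooses $Q_q$ in $\mathcal Q_q(P_q)=\{Q\in\mathbb C^{n_{T_q}\times n_{T_q}}: Q\succeq 0,\ \operatorname{Tr}Q\le P_q\}$ so as to maximize $$\frac{\log\det\big(I+H_{qq}^H R_{-q}^{-1}H_{qq}Q_q\big)}{\Psi_q+\operatorname{Tr}Q_q},\qquad R_{-q}=R_{n_q}+\sum_{r\ne q}H_{qr}Q_rH_{qr}^H .$$ Let $H_{qq}=U_q\Sigma_qV_q^H$ be compact singular value decompositions, with $\Sigma_q$ of size $r_q=\operatorname{rank}H_{qq}$, and put $\bar H_{qr}=H_{qr}V_r$. The reduced game is the game obtained in the same way from the channels $\bar H_{qr}$: its strategies $\bar Q_q$ are positive semidefinite $r_q\times r_q$ matrices with $\operatorname{Tr}\bar Q_q\le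 P_q$, and $\bar{\mathcal Q}(\mathbf p)$ denotes its set of strategy profiles. For $\bar Q\in\bar{\mathcal Q}(\mathbf p)$ let $\hat P_q(\bar Q_{-q})=\min(P_q,P_q^u)$, where $P_q^u$ is the trace of the maximizer of the reduced energy efficiency of user $q$ over all $\bar Q_q\succeq 0$ (the other strategies being fixed, and without power constraint), and let $\hat{\mathbf p}(\bar Q)=(\hat P_q(\bar Q_{-q}))_q$. Statement. Assume that all $\bar H_{qq}$ are square and nonsingular. Let $\bar S$ be the nonnegative $Q\times Q$ matrix with $[\bar S]_{qr}=\sigma_{\max}^2(\bar H_{qq}^{-1}\bar H_{qr})$ for $r\ne q$ and $[\bar S]_{qq}=0$, let $\rho(\bar S)$ be its spectral radius, and let $\mathbf w$ be a right Perron eigenvector of $\bar S$ with strictly positive entries: $\bar S\mathbf w=\rho(\bar S)\mathbf w$. Put $\|\mathbf u\|_\infty^{\mathbf w}=\max_q|u_q|/w_q$ and $\|\bar Q\|_F^{\mathbf w}=\max_q\|\bar Q_q\|_F/w_q$. If $$\|\hat{\mathbf p}(\bar Q)-\hat{\mathbf p}(\bar Q')\|_\infty^{\mathbf w}<(1-\rho(\bar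 S))\,\|\bar Q-\bar Q'\|_F^{\mathbf w}\qquad\text{for all }\bar Q\ne\bar Q'\text{ in }\bar{\mathcal Q}(\mathbf p),$$ then every $\bar Q\in\bar{\mathcal Q}(\mathbf p)$ has exactly one best-response profile $\mathrm{BR}(\bar Q)$ in the reduced game, and the best-response map is a contraction: there is $\beta\in[0,1)$ with $\|\mathrm{BR}(\bar Q)-\mathrm{BR}(\bar Q')\|_F^{\mathbf w}\le\beta\,\|\bar Q-\bar Q'\|_F^{\mathbf w}$ for all $\bar Q,\bar Q'\in\bar{\mathcal Q}(\mathbf p)$. Moreover the reduced game and the game $\mathcal G_E$ each have exactly one (pure) Nash equilibrium. -/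

import Mathlib

open scoped Matrix ComplexOrder

noncomputable section

/-- Frobenius norm of a complex matrix. -/
def frobeniusNorm {m n : Type*} [Fintype m] [Fintype n] (A : Matrix m n ℂ) : ℝ :=
  letI := Matrix.frobeniusNormedAddCommGroup (m := m) (n := n) (α := ℂ)
  ‖A‖

/-- Largest singular value of a complex matrix (the singular values are listed in
nonincreasing order, starting from index `0`). -/
def maxSingularValue {m n : Type*} [Fintype m] [Fintype n] [DecidableEq n]
    (A : Matrix m n ℂ) : ℝ :=
  (Matrix.toEuclideanLin A).singularValues 0

/-- Spectral radius of a real matrix: the largest modulus of its complex eigenvalues. -/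
def realSpectralRadius {ι : Type*} [Fintype ι] [DecidableEq ι] (S : Matrix ι ι ℝ) : ℝ :=
  (spectralRadius ℂ (S.map (algebraMap ℝ ℂ))).toReal

/-- `w` is a (strictly positive) right Perron eigenvector of the nonnegative matrix `S`: an
eigenvector for the eigenvalue equal to the spectral radius of `S`. -/
def IsRightPerronEigenvector {ι : Type*} [Fintype ι] [DecidableEq ι]
    (S : Matrix ι ι ℝ) (w : ι → ℝ) : Prop :=
  (∀ q, 0 < w q) ∧ S *ᵥ w = realSpectralRadius S • w

/-- Weighted maximum norm `max_q |u_q| / w_q` of a real vector. -/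
def weightedMaxNorm {ι : Type*} (w : ι → ℝ) (u : ι → ℝ) : ℝ :=
  ⨆ q, |u q| / w q

/-- Weighted block-maximum norm `max_q ‖X_q‖_F / w_q` of a family of matrices. -/
def weightedBlockMaxNorm {ι : Type*} {n : ι → ℕ} (w : ι → ℝ)
    (X : ∀ q, Matrix (Fin (n q)) (Fin (n q)) ℂ) : ℝ :=
  ⨆ q, frobeniusNorm (X q) / w q

/-- `A = U diag(s) Vᴴ` is a compact singular value decomposition of `A`, of rank `k`: `U` and `V`
are semi-unitary and the `k` singular values `s` are positive. -/
structure IsCompactSVD {m n k : ℕ} (A : Matrix (Fin m) (Fin n) ℂ)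
    (U : Matrix (Fin m) (Fin k) ℂ) (s : Fin k → ℝ) (V : Matrix (Fin n) (Fin k) ℂ) : Prop where
  left_semiunitary : Uᴴ * U = 1
  right_semiunitary : Vᴴ * V = 1
  pos : ∀ i, 0 < s i
  eq_mul : A = U * Matrix.diagonal (fun i => (s i : ℂ)) * Vᴴ

/-- A MIMO interference network whose users (transmitter-receiver pairs) are indexed by `ι`;
user `q` has `nT q` transmit and `nR q` receive antennas. -/
structure MIMONetwork {ι : Type*} (nT nR : ι → ℕ) where
  /-- `H q r` is the channel from the `r`-th transmitter to the `q`-th receiver. -/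
  H : ∀ q r, Matrix (Fin (nR q)) (Fin (nT r)) ℂ
  /-- Noise covariance matrices. -/
  noise : ∀ q, Matrix (Fin (nR q)) (Fin (nR q)) ℂ
  noise_posDef : ∀ q, (noise q).PosDef
  /-- Circuitry powers. -/
  Ψ : ι → ℝ
  Ψ_pos : ∀ q, 0 < Ψ q
  /-- Maximum transmit powers. -/
  P : ι → ℝ
  P_nonneg : ∀ q, 0 ≤ P q

namespace MIMONetwork

variable {ι : Type*} {nT nR : ι → ℕ}

/-- Strategy profiles: one (covariance) matrix per user. -/
abbrev Profile (nT : ι → ℕ) : Type _ := ∀ q, Matrix (Fin (nT q)) (Fin (nT q)) ℂ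

/-- Power `Tr X` of a covariance matrix (the trace of a Hermitian matrix is real). -/
def power {n : ℕ} (X : Matrix (Fin n) (Fin n) ℂ) : ℝ := X.trace.re

/-- Strategy set of user `q`: positive semidefinite matrices of trace at most `P q`. -/
def strategySet (N : MIMONetwork nT nR) (q : ι) : Set (Matrix (Fin (nT q)) (Fin (nT q)) ℂ) :=
  {X | X.PosSemidef ∧ power X ≤ N.P q}

/-- Joint strategy set: the Cartesian product of the strategy sets. -/
def jointStrategySet (N : MIMONetwork nT nR) : Set (Profile nT) :=
  {X | ∀ q, X q ∈ N.strategySet q}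

section Game

variable [Fintype ι] [DecidableEq ι]

/-- Interference-plus-noise covariance matrix at receiver `q`; it depends only on the strategies
`X r` of the users `r ≠ q`. -/
def interferenceCov (N : MIMONetwork nT nR) (q : ι) (X : Profile nT) :
    Matrix (Fin (nR q)) (Fin (nR q)) ℂ :=
  N.noise q + ∑ r ∈ Finset.univ.erase q, N.H q r * X r * (N.H q r)ᴴ

/-- Rate of user `q` playing `Y` against the other users' strategies in `X`. For positive
semidefinite strategies the determinant is a real number, at least `1`. -/
def rate (N : MIMONetwork nT nR) (q : ι) (Y : Matrix (Fin (nT q)) (Fin (nT q)) ℂ)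
    (X : Profile nT) : ℝ :=
  Real.log (Matrix.det (1 + (N.H q q)ᴴ * (N.interferenceCov q X)⁻¹ * N.H q q * Y)).re

/-- Energy efficiency of user `q` playing `Y` against the other users' strategies in `X`. -/
def energyEfficiency (N : MIMONetwork nT nR) (q : ι)
    (Y : Matrix (Fin (nT q)) (Fin (nT q)) ℂ) (X : Profile nT) : ℝ :=
  N.rate q Y X / (N.Ψ q + power Y)

/-- Best responses of user `q`: the maximizers of its energy efficiency over its strategy set,
the other users' strategies (in `X`) being fixed. -/
def bestResponse (N : MIMONetwork nT nR) (q : ι) (X : Profile nT) :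
    Set (Matrix (Fin (nT q)) (Fin (nT q)) ℂ) :=
  {Y | Y ∈ N.strategySet q ∧
    ∀ Z ∈ N.strategySet q, N.energyEfficiency q Z X ≤ N.energyEfficiency q Y X}

/-- `B` is a profile of best responses to the profile `X`. -/
def IsBestResponseProfile (N : MIMONetwork nT nR) (X B : Profile nT) : Prop :=
  ∀ q, B q ∈ N.bestResponse q X

/-- (Pure) Nash equilibria of the energy-efficiency game of the network: every user's strategy
is a best response to those of the others. -/
def IsNashEquilibrium (N : MIMONetwork nT nR) (X : Profile nT) : Prop :=
  N.IsBestResponseProfile X X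

/-- `Y` maximizes the energy efficiency of user `q` among all positive semidefinite matrices,
without any bound on the transmit power. -/
def IsUnconstrainedMaximizer (N : MIMONetwork nT nR) (q : ι) (X : Profile nT)
    (Y : Matrix (Fin (nT q)) (Fin (nT q)) ℂ) : Prop :=
  Y.PosSemidef ∧
    ∀ Z : Matrix (Fin (nT q)) (Fin (nT q)) ℂ, Z.PosSemidef →
      N.energyEfficiency q Z X ≤ N.energyEfficiency q Y X

/-- Unconstrained optimal power of user `q`: the trace of the unconstrained maximizer of its
energy efficiency. (If the direct channel `H q q` has full column rank and the other users'
strategies are positive semidefinite, there is exactly one maximizer.) -/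
def unconstrainedPower (N : MIMONetwork nT nR) (q : ι) (X : Profile nT) : ℝ :=
  power (Classical.epsilon fun Y => N.IsUnconstrainedMaximizer q X Y)

/-- The power mapping: the optimal power of each user given the strategies of the others. -/
def optimalPower (N : MIMONetwork nT nR) (X : Profile nT) : ι → ℝ :=
  fun q => min (N.P q) (N.unconstrainedPower q X)

end Game

/-- The network obtained by restricting the strategies of each user `r` to the form
`V r * X r * (V r)ᴴ`: every channel `H q r` is replaced by `H q r * V r`. -/
def reduced (N : MIMONetwork nT nR) {k : ι → ℕ}
    (V : ∀ q, Matrix (Fin (nT q)) (Fin (k q)) ℂ) : MIMONetwork k nR where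
  H := fun q r => N.H q r * V r
  noise := N.noise
  noise_posDef := N.noise_posDef
  Ψ := N.Ψ
  Ψ_pos := N.Ψ_pos
  P := N.P
  P_nonneg := N.P_nonneg

/-- Interference matrix of a network whose direct channels are square. -/
def interferenceMatrix [DecidableEq ι] {n : ι → ℕ} (N : MIMONetwork n n) : Matrix ι ι ℝ :=
  Matrix.of fun q r =>
    if r ≠ q then maxSingularValue ((N.H q q)⁻¹ * N.H q r) ^ 2 else 0

end MIMONetwork

end

/-! Inverting the square direct channel turns the rate of user `q` into `log det (K + Y) - log det
K`, where `K` is the effective noise covariance, affine in the other users' strategies. By strict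
concavity of `log det`, at a price `ν⁻¹` per unit of power the net rate has a unique maximizer: the
water-filling matrix `(ν - K)₊`. The ratio of rate to power is maximized at the level whose price
equals the efficiency attained there, or, if that needs too much power, at the level that exhausts
the budget. Hence the best response is water-filling over `K` with the power given by the power
mapping (`exists_efficiency_maximizer`, `exists_waterfill_bestResponse`).

Let `d` be the weighted distance of two profiles. At fixed power, water-filling is the projection of
`-K` onto the positive semidefinite matrices of that trace, hence nonexpansive in `K`; the Perron
equation bounds the change of `K` by `ρ * w q * d`. At fixed `K`, water-filling solutions are
totally ordered, so their Frobenius distance is at most the change of power, here at most `(1 - ρ) *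
w q * d`. The triangle inequality then yields only a bound by `d`: the strict hypothesis is not
uniform and gives no factor below one. The margin comes from geometry: the first change is traceless
and the second is semidefinite up to sign, so the cosine of their angle is at most `√(1 - 1/n) < 1`
(`frobeniusNorm_waterfill_sub_sq_le`). This is a uniform gain when `0 < ρ < 1`; when `ρ = 0` the
best response is constant.

Banach's theorem gives the equilibrium of the reduced game. In the original game the rate of `Y`
depends only on `Vᴴ * Y * V`, while the trace can only drop under this compression, so best
responses live on the range of `V` and the equilibria of the two games correspond. -/

noncomputable section

/-! ### Frobenius norm and the real inner product behind it. -/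

section Frobenius

variable {l m n : Type*} [Fintype l] [Fintype m] [Fintype n]

/-- Real part of the Frobenius inner product. -/
def frobeniusInner (A B : Matrix m n ℂ) : ℝ := (Aᴴ * B).trace.re

theorem frobeniusNorm_sq_eq_sum (A : Matrix m n ℂ) :
    frobeniusNorm A ^ 2 = ∑ i, ∑ j, ‖A i j‖ ^ 2 := by
  unfold frobeniusNorm
  rw [Matrix.frobenius_norm_def, ← Real.sqrt_eq_rpow, Real.sq_sqrt (by positivity)]
  simp

theorem frobeniusNorm_nonneg (A : Matrix m n ℂ) : 0 ≤ frobeniusNorm A := by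
  let := Matrix.frobeniusNormedAddCommGroup (m := m) (n := n) (α := ℂ)
  exact norm_nonneg A

theorem frobeniusNorm_add_le (A B : Matrix m n ℂ) :
    frobeniusNorm (A + B) ≤ frobeniusNorm A + frobeniusNorm B := by
  let := Matrix.frobeniusNormedAddCommGroup (m := m) (n := n) (α := ℂ)
  exact norm_add_le A B

theorem frobeniusNorm_sum_le {κ : Type*} (s : Finset κ) (f : κ → Matrix m n ℂ) :
    frobeniusNorm (∑ i ∈ s, f i) ≤ ∑ i ∈ s, frobeniusNorm (f i) := by
  let := Matrix.frobeniusNormedAddCommGroup (m := m) (n := n) (α := ℂ)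
  exact norm_sum_le s f

theorem frobeniusNorm_sub_comm (A B : Matrix m n ℂ) :
    frobeniusNorm (A - B) = frobeniusNorm (B - A) := by
  let := Matrix.frobeniusNormedAddCommGroup (m := m) (n := n) (α := ℂ)
  exact norm_sub_rev A B

theorem frobeniusNorm_zero : frobeniusNorm (0 : Matrix m n ℂ) = 0 := by
  let := Matrix.frobeniusNormedAddCommGroup (m := m) (n := n) (α := ℂ)
  exact norm_zero

theorem frobeniusNorm_conjTranspose (A : Matrix m n ℂ) :
    frobeniusNorm Aᴴ = frobeniusNorm A :=
  Matrix.frobenius_norm_conjTranspose A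

theorem frobeniusInner_self (A : Matrix m n ℂ) : frobeniusInner A A = frobeniusNorm A ^ 2 := by
  rw [frobeniusNorm_sq_eq_sum, frobeniusInner, Matrix.trace, Complex.re_sum, Finset.sum_comm]
  refine Finset.sum_congr rfl fun j _ => ?_
  rw [Matrix.diag_apply, Matrix.mul_apply, Complex.re_sum]
  refine Finset.sum_congr rfl fun i _ => ?_
  rw [Matrix.conjTranspose_apply, ← Complex.normSq_eq_norm_sq, Complex.normSq_apply]
  simp

theorem frobeniusInner_add_left (A B C : Matrix m n ℂ) :
    frobeniusInner (A + B) C = frobeniusInner A C + frobeniusInner B C := by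
  simp only [frobeniusInner, Matrix.conjTranspose_add, Matrix.add_mul, Matrix.trace_add, Complex.add_re]

theorem frobeniusInner_sub_left (A B C : Matrix m n ℂ) :
    frobeniusInner (A - B) C = frobeniusInner A C - frobeniusInner B C := by
  simp only [frobeniusInner, Matrix.conjTranspose_sub, Matrix.sub_mul, Matrix.trace_sub, Complex.sub_re]

theorem frobeniusInner_add_right (A B C : Matrix m n ℂ) :
    frobeniusInner A (B + C) = frobeniusInner A B + frobeniusInner A C := by
  simp only [frobeniusInner, Matrix.mul_add, Matrix.trace_add, Complex.add_re]

theorem frobeniusInner_sub_right (A B C : Matrix m n ℂ) :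
    frobeniusInner A (B - C) = frobeniusInner A B - frobeniusInner A C := by
  simp only [frobeniusInner, Matrix.mul_sub, Matrix.trace_sub, Complex.sub_re]

theorem frobeniusInner_comm (A B : Matrix m n ℂ) : frobeniusInner A B = frobeniusInner B A := by
  have h : (Bᴴ * A) = (Aᴴ * B)ᴴ := by simp
  rw [frobeniusInner, frobeniusInner, h, Matrix.trace_conjTranspose]
  simp

theorem frobeniusNorm_add_sq (A B : Matrix m n ℂ) :
    frobeniusNorm (A + B) ^ 2 =
      frobeniusNorm A ^ 2 + 2 * frobeniusInner A B + frobeniusNorm B ^ 2 := by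
  rw [← frobeniusInner_self, frobeniusInner_add_left, frobeniusInner_add_right,
    frobeniusInner_add_right, frobeniusInner_comm B A, frobeniusInner_self, frobeniusInner_self]
  ring

/-- Cauchy–Schwarz, read off by comparing the expansion of `‖A + B‖²` with the squared triangle
inequality. -/
theorem frobeniusInner_le (A B : Matrix m n ℂ) :
    frobeniusInner A B ≤ frobeniusNorm A * frobeniusNorm B := by
  have h := frobeniusNorm_add_sq A B
  have h2 := pow_le_pow_left₀ (frobeniusNorm_nonneg _) (frobeniusNorm_add_le A B) 2
  nlinarith

theorem frobeniusNorm_eq_zero {A : Matrix m n ℂ} : frobeniusNorm A = 0 ↔ A = 0 := by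
  let := Matrix.frobeniusNormedAddCommGroup (m := m) (n := n) (α := ℂ)
  exact norm_eq_zero

end Frobenius

/-! ### The largest singular value as a Lipschitz constant. -/

section MaxSingularValue

variable {l m n : Type*} [Fintype l] [Fintype m] [Fintype n]

/-- In an orthonormal eigenbasis of `T* T` the form `‖T x‖²` is diagonal, with the squared singular
values as coefficients, and index `0` carries the largest. -/
theorem LinearMap.norm_apply_le_singularValues_zero {E F : Type*} [NormedAddCommGroup E]
    [InnerProductSpace ℂ E] [FiniteDimensional ℂ E] [NormedAddCommGroup F]
    [InnerProductSpace ℂ F] [FiniteDimensional ℂ F] (T : E →ₗ[ℂ] F) (x : E) :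
    ‖T x‖ ^ 2 ≤ T.singularValues 0 ^ 2 * ‖x‖ ^ 2 := by
  set b := T.isSymmetric_adjoint_comp_self.eigenvectorBasis rfl with hb
  have h1 : ‖T x‖ ^ 2 =
      ∑ i : Fin (Module.finrank ℂ E), T.singularValues i ^ 2 * ‖inner ℂ (b i) x‖ ^ 2 := by
    have h2 : (‖T x‖ ^ 2 : ℝ) = (inner ℂ x ((T.adjoint ∘ₗ T) x)).re := by
      rw [LinearMap.comp_apply, LinearMap.adjoint_inner_right, inner_self_eq_norm_sq_to_K]
      norm_cast
    rw [h2, ← b.sum_inner_mul_inner, Complex.re_sum]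
    refine Finset.sum_congr rfl fun i _ => ?_
    rw [← T.isSymmetric_adjoint_comp_self (b i) x,
      T.isSymmetric_adjoint_comp_self.apply_eigenvectorBasis rfl i, inner_smul_left,
      T.sq_singularValues_fin rfl i, ← inner_conj_symm x (b i)]
    rw [mul_left_comm, Complex.conj_mul']
    simp [← Complex.ofReal_pow]
  rw [h1, ← b.sum_sq_norm_inner_right x, Finset.mul_sum]
  refine Finset.sum_le_sum fun i _ => ?_
  have := T.singularValues_antitone (Nat.zero_le i)
  have h0 := T.singularValues_nonneg i
  gcongr

theorem maxSingularValue_nonneg [DecidableEq n] (G : Matrix m n ℂ) : 0 ≤ maxSingularValue G :=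
  LinearMap.singularValues_nonneg _ _

theorem frobeniusNorm_mul_le_maxSingularValue [DecidableEq n] (G : Matrix m n ℂ)
    (D : Matrix n l ℂ) : frobeniusNorm (G * D) ≤ maxSingularValue G * frobeniusNorm D := by
  refine le_of_sq_le_sq ?_ (mul_nonneg (maxSingularValue_nonneg G) (frobeniusNorm_nonneg D))
  rw [mul_pow, frobeniusNorm_sq_eq_sum, frobeniusNorm_sq_eq_sum, Finset.sum_comm,
    Finset.sum_comm (γ := n), Finset.mul_sum]
  refine Finset.sum_le_sum fun j _ => ?_
  have h := LinearMap.norm_apply_le_singularValues_zero (Matrix.toEuclideanLin G)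
    (WithLp.toLp 2 (fun i => D i j))
  rw [EuclideanSpace.norm_sq_eq, EuclideanSpace.norm_sq_eq] at h
  exact h

/-- Each of the two factors `G` costs one singular value, the right one after passing to the
adjoint. This is the source of the squares in the interference matrix. -/
theorem frobeniusNorm_conj_le_maxSingularValue [DecidableEq n] (G : Matrix m n ℂ)
    (D : Matrix n n ℂ) :
    frobeniusNorm (G * D * Gᴴ) ≤ maxSingularValue G ^ 2 * frobeniusNorm D := by
  rw [Matrix.mul_assoc]
  refine (frobeniusNorm_mul_le_maxSingularValue _ _).trans ?_
  have h := frobeniusNorm_mul_le_maxSingularValue G Dᴴ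
  rw [← frobeniusNorm_conjTranspose, frobeniusNorm_conjTranspose D, Matrix.conjTranspose_mul,
    Matrix.conjTranspose_conjTranspose] at h
  rw [sq, mul_assoc]
  exact mul_le_mul_of_nonneg_left h (maxSingularValue_nonneg G)

end MaxSingularValue

/-! ### Positive semidefinite matrices and concavity of `log det`. -/

namespace Matrix

variable {m n : Type*} [Fintype m] [Fintype n]

open scoped MatrixOrder in
theorem PosSemidef.exists_eq_conjTranspose_mul_self [DecidableEq n] {A : Matrix n n ℂ}
    (hA : A.PosSemidef) : ∃ C : Matrix n n ℂ, A = Cᴴ * C :=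
  CStarAlgebra.nonneg_iff_eq_star_mul_self.mp hA.nonneg

theorem PosSemidef.trace_mul_re_nonneg [DecidableEq n] {A B : Matrix n n ℂ} (hA : A.PosSemidef)
    (hB : B.PosSemidef) : 0 ≤ (A * B).trace.re := by
  obtain ⟨C, rfl⟩ := hA.exists_eq_conjTranspose_mul_self
  rw [mul_assoc, trace_mul_comm]
  exact (Complex.nonneg_iff.1 (hB.mul_mul_conjTranspose_same C).trace_nonneg).1

/-- The Frobenius norm of a positive semidefinite matrix is at most its trace. -/
theorem PosSemidef.frobeniusNorm_le_trace [DecidableEq n] {A : Matrix n n ℂ}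
    (hA : A.PosSemidef) : frobeniusNorm A ≤ A.trace.re := by
  have h0 : 0 ≤ A.trace.re := (Complex.nonneg_iff.1 hA.trace_nonneg).1
  refine le_of_sq_le_sq ?_ h0
  have hev := hA.eigenvalues_nonneg
  have ht : A.trace.re = ∑ i, hA.1.eigenvalues i := by
    rw [hA.1.trace_eq_sum_eigenvalues]; simp
  have hs : frobeniusNorm A ^ 2 = ∑ i, hA.1.eigenvalues i ^ 2 := by
    rw [← frobeniusInner_self, frobeniusInner, hA.1.eq]
    have hsp := hA.1.spectral_theorem
    conv_lhs => rw [hsp, ← map_mul, diagonal_mul_diagonal, Unitary.conjStarAlgAut_apply,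
      trace_mul_cycle, Unitary.coe_star_mul_self, one_mul, trace_diagonal]
    simp [sq]
  rw [ht, hs, sq, Finset.sum_mul]
  refine Finset.sum_le_sum fun i _ => ?_
  rw [sq]
  exact mul_le_mul_of_nonneg_left
    (Finset.single_le_sum (fun j _ => hev j) (Finset.mem_univ i)) (hev i)

/-- `log det A`, as a real number. -/
def logDet [DecidableEq n] (A : Matrix n n ℂ) : ℝ := Real.log A.det.re

theorem PosDef.det_re_pos [DecidableEq n] {A : Matrix n n ℂ} (hA : A.PosDef) : 0 < A.det.re :=
  (Complex.pos_iff.1 hA.det_pos).1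

theorem PosDef.ofReal_det_re [DecidableEq n] {A : Matrix n n ℂ} (hA : A.PosDef) :
    (A.det.re : ℂ) = A.det :=
  Complex.ext rfl (by simpa using (Complex.pos_iff.1 hA.det_pos).2)

theorem PosDef.logDet_eq_sum [DecidableEq n] {A : Matrix n n ℂ} (hA : A.PosDef) :
    logDet A = ∑ i, Real.log (hA.1.eigenvalues i) := by
  rw [logDet, hA.1.det_eq_prod_eigenvalues,
    ← Real.log_prod fun i _ => (hA.eigenvalues_pos i).ne']
  congr 1
  norm_cast

/-- Sum `log x ≤ x - 1` over the eigenvalues; equality holds only at `x = 1`. This is the gradient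
inequality at the identity, to which `PosDef.logDet_le` reduces by congruence. -/
theorem PosDef.logDet_le_trace_sub_card [DecidableEq n] {W : Matrix n n ℂ} (hW : W.PosDef) :
    logDet W ≤ W.trace.re - Fintype.card n ∧
      (logDet W = W.trace.re - Fintype.card n → W = 1) := by
  have ht : W.trace.re - Fintype.card n = ∑ i, (hW.1.eigenvalues i - 1) := by
    rw [hW.1.trace_eq_sum_eigenvalues]; simp
  rw [ht, hW.logDet_eq_sum]
  have hle : ∀ i ∈ Finset.univ, Real.log (hW.1.eigenvalues i) ≤ hW.1.eigenvalues i - 1 :=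
    fun i _ => Real.log_le_sub_one_of_pos (hW.eigenvalues_pos i)
  refine ⟨Finset.sum_le_sum hle, fun h => ?_⟩
  have h1 : ∀ i, hW.1.eigenvalues i = 1 := fun i => by
    by_contra hne
    exact (Real.log_lt_sub_one_of_pos (hW.eigenvalues_pos i) hne).ne
      ((Finset.sum_eq_sum_iff_of_le hle).1 h i (Finset.mem_univ i))
  have hsp := hW.1.spectral_theorem
  have hd : diagonal (RCLike.ofReal ∘ hW.1.eigenvalues) = (1 : Matrix n n ℂ) := by
    rw [← diagonal_one]; congr 1; ext i; simp [h1 i]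
  rw [hsp, hd, map_one]

/-- Strict concavity of `log det` on the positive definite matrices, as a gradient inequality. -/
theorem PosDef.logDet_le [DecidableEq n] {A B : Matrix n n ℂ} (hA : A.PosDef) (hB : B.PosDef) :
    logDet B ≤ logDet A + ((A⁻¹ * B).trace.re - Fintype.card n) ∧
      (logDet B = logDet A + ((A⁻¹ * B).trace.re - Fintype.card n) → B = A) := by
  obtain ⟨C, hC⟩ := hA.posSemidef.exists_eq_conjTranspose_mul_self
  have hCdet : IsUnit C.det := by
    have h := hA.det_pos.ne'
    rw [hC, det_mul] at h
    exact (right_ne_zero_of_mul h).isUnit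
  have hCu : IsUnit C := (isUnit_iff_isUnit_det C).2 hCdet
  have hSu : IsUnit C⁻¹ := (isUnit_nonsing_inv_iff).2 hCu
  set W := (C⁻¹)ᴴ * B * C⁻¹ with hWdef
  have hW : W.PosDef := (IsUnit.posDef_star_left_conjugate_iff hSu).2 hB
  have hBW : B = Cᴴ * W * C := by
    have e1 : C⁻¹ * C = 1 := nonsing_inv_mul C hCdet
    have e2 : Cᴴ * (C⁻¹)ᴴ = 1 := by rw [← conjTranspose_mul, e1, conjTranspose_one]
    calc B = (Cᴴ * (C⁻¹)ᴴ) * B * (C⁻¹ * C) := by rw [e1, e2, one_mul, mul_one]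
      _ = Cᴴ * W * C := by simp only [hWdef, mul_assoc]
  have htr : (A⁻¹ * B).trace = W.trace := by
    rw [hC, mul_inv_rev, hWdef, ← conjTranspose_nonsing_inv, mul_assoc, trace_mul_comm]
  have hdet : B.det = A.det * W.det := by
    rw [hBW, hC]; simp only [det_mul]; ring
  have hld : logDet B = logDet A + logDet W := by
    rw [logDet, hdet, ← hA.ofReal_det_re, Complex.re_ofReal_mul,
      Real.log_mul hA.det_re_pos.ne' hW.det_re_pos.ne']
    rfl
  rw [hld, htr]
  obtain ⟨h1, h2⟩ := hW.logDet_le_trace_sub_card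
  refine ⟨by linarith, fun h => ?_⟩
  rw [hBW, h2 (by linarith), mul_one, ← hC]

end Matrix

/-! ### Water-filling and its dependence on matrix and power. -/

namespace Matrix

variable {n : Type*} [Fintype n] [DecidableEq n] {K K' : Matrix n n ℂ}

namespace IsHermitian

variable (hK : K.IsHermitian)

theorem cfc_mul_cfc (f g : ℝ → ℝ) : hK.cfc f * hK.cfc g = hK.cfc (fun x => f x * g x) := by
  simp only [IsHermitian.cfc, ← map_mul, diagonal_mul_diagonal]
  congr 2; ext i; simp

theorem cfc_add_cfc (f g : ℝ → ℝ) : hK.cfc f + hK.cfc g = hK.cfc (fun x => f x + g x) := by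
  simp only [IsHermitian.cfc, ← map_add, diagonal_add]
  congr 2; ext i; simp

theorem cfc_sub_cfc (f g : ℝ → ℝ) : hK.cfc f - hK.cfc g = hK.cfc (fun x => f x - g x) := by
  simp only [IsHermitian.cfc, ← map_sub, diagonal_sub]
  congr 2; ext i; simp

theorem cfc_congr_eigenvalues {f g : ℝ → ℝ} (h : ∀ i, f (hK.eigenvalues i) = g (hK.eigenvalues i)) :
    hK.cfc f = hK.cfc g := by
  simp only [IsHermitian.cfc]
  congr 2; ext i; simp [h i]

theorem cfc_id_eq : hK.cfc (fun x => x) = K := by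
  conv_rhs => rw [hK.spectral_theorem]
  rfl

theorem cfc_one_eq : hK.cfc (fun _ => 1) = 1 := by
  have : diagonal (RCLike.ofReal ∘ (fun _ : ℝ => (1 : ℝ)) ∘ hK.eigenvalues) =
      (1 : Matrix n n ℂ) := by
    rw [← diagonal_one]; congr 1
  rw [IsHermitian.cfc, this, map_one]

theorem trace_cfc (f : ℝ → ℝ) : (hK.cfc f).trace.re = ∑ i, f (hK.eigenvalues i) := by
  rw [IsHermitian.cfc, Unitary.conjStarAlgAut_apply, trace_mul_cycle, Unitary.coe_star_mul_self,
    one_mul, trace_diagonal]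
  simp

theorem det_cfc (f : ℝ → ℝ) : (hK.cfc f).det.re = ∏ i, f (hK.eigenvalues i) := by
  rw [IsHermitian.cfc, Unitary.conjStarAlgAut_apply, det_mul_comm, ← mul_assoc,
    Unitary.coe_star_mul_self, one_mul, det_diagonal]
  simp only [Function.comp_apply, Complex.coe_algebraMap]
  norm_cast

theorem posSemidef_cfc {f : ℝ → ℝ} (h : ∀ i, 0 ≤ f (hK.eigenvalues i)) :
    (hK.cfc f).PosSemidef := by
  rw [IsHermitian.cfc, Unitary.conjStarAlgAut_apply]
  refine PosSemidef.mul_mul_conjTranspose_same (PosSemidef.diagonal fun i => ?_) _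
  simpa using h i

/-- The water-filling solution with water level `ν` over the Hermitian matrix `K`: the positive
part of `ν - K`. -/
def waterfill (ν : ℝ) : Matrix n n ℂ := hK.cfc fun x => max (ν - x) 0

/-- The power of the water-filling solution with water level `ν`. -/
def waterPower (ν : ℝ) : ℝ := ∑ i, max (ν - hK.eigenvalues i) 0

theorem posSemidef_waterfill (ν : ℝ) : (hK.waterfill ν).PosSemidef :=
  hK.posSemidef_cfc fun _ => le_max_right _ _

theorem trace_waterfill (ν : ℝ) : (hK.waterfill ν).trace.re = hK.waterPower ν :=
  hK.trace_cfc _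

theorem add_waterfill (ν : ℝ) : K + hK.waterfill ν = hK.cfc fun x => max ν x := by
  conv_lhs => enter [1]; rw [← hK.cfc_id_eq]
  rw [waterfill, cfc_add_cfc]
  congr 1; ext x; rw [← max_add_add_left]; simp

theorem waterPower_nonneg (ν : ℝ) : 0 ≤ hK.waterPower ν :=
  Finset.sum_nonneg fun _ _ => le_max_right _ _

theorem monotone_waterPower : Monotone hK.waterPower := fun _ _ h =>
  Finset.sum_le_sum fun _ _ => max_le_max_right _ (sub_le_sub_right h _)

theorem continuous_waterPower : Continuous hK.waterPower := by
  unfold waterPower; fun_prop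

/-- Water-filling over a fixed matrix is monotone in the water level, hence `1`-Lipschitz in the
power. -/
theorem frobeniusNorm_waterfill_sub_le (ν ν' : ℝ) :
    frobeniusNorm (hK.waterfill ν - hK.waterfill ν') ≤
      |hK.waterPower ν - hK.waterPower ν'| := by
  wlog h : ν' ≤ ν generalizing ν ν'
  · rw [frobeniusNorm_sub_comm, abs_sub_comm]
    exact this ν' ν (le_of_not_ge h)
  have hp : (hK.waterfill ν - hK.waterfill ν').PosSemidef := by
    rw [waterfill, waterfill, cfc_sub_cfc]
    refine hK.posSemidef_cfc fun i => sub_nonneg.2 (max_le_max_right _ (sub_le_sub_right h _))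
  refine hp.frobeniusNorm_le_trace.trans ?_
  rw [trace_sub, Complex.sub_re, trace_waterfill, trace_waterfill]
  exact le_abs_self _

/-- The variational inequality that characterizes a water-filling solution as a projection. -/
theorem le_frobeniusInner_add_waterfill (ν : ℝ) {Z : Matrix n n ℂ} (hZ : Z.PosSemidef) :
    ν * (Z.trace.re - hK.waterPower ν) ≤
      frobeniusInner (K + hK.waterfill ν) (Z - hK.waterfill ν) := by
  have hA : (K + hK.waterfill ν)ᴴ = K + hK.waterfill ν := by
    rw [conjTranspose_add, hK.eq, (hK.posSemidef_waterfill ν).1.eq]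
  -- `K + waterfill ν` is `max ν K`: the scalar `ν` plus a positive semidefinite excess. The excess
  -- lives where `K > ν`, where the water-filling matrix vanishes, so their product is zero
  -- (complementary slackness).
  have hdec : K + hK.waterfill ν = hK.cfc (fun x => max ν x - ν) + (ν : ℂ) • 1 := by
    have : ((ν : ℂ) • 1 : Matrix n n ℂ) = hK.cfc fun _ => ν := by
      have h1 : diagonal (RCLike.ofReal ∘ (fun _ : ℝ => ν) ∘ hK.eigenvalues) =
          ((ν : ℂ) • 1 : Matrix n n ℂ) := by
        rw [← diagonal_one, ← diagonal_smul]; congr 1; ext i; simp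
      rw [IsHermitian.cfc, h1, map_smul, map_one]
    rw [this, cfc_add_cfc, add_waterfill]
    simp
  have h0 : hK.cfc (fun x => max ν x - ν) * hK.waterfill ν = hK.cfc fun _ => 0 := by
    rw [waterfill, cfc_mul_cfc]
    refine hK.cfc_congr_eigenvalues fun i => ?_
    generalize hK.eigenvalues i = x
    rcases le_total ν x with h | h
    · rw [max_eq_right (sub_nonpos.2 h), mul_zero]
    · rw [max_eq_left h, sub_self, zero_mul]
  have hpos : 0 ≤ (hK.cfc (fun x => max ν x - ν) * Z).trace.re :=
    PosSemidef.trace_mul_re_nonneg (hK.posSemidef_cfc (f := fun x => max ν x - ν)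
      fun i => sub_nonneg.2 (le_max_left _ _)) hZ
  rw [frobeniusInner, hA, hdec, Matrix.add_mul, Matrix.mul_sub _ Z, h0, trace_add, trace_sub]
  simp only [smul_mul, one_mul, trace_smul, trace_sub, Complex.sub_re, Complex.add_re, smul_eq_mul,
    Complex.re_ofReal_mul, trace_cfc, trace_waterfill, Finset.sum_const_zero]
  linarith

/-- Water-filling with a fixed power is nonexpansive in the matrix to be filled. -/
theorem frobeniusNorm_waterfill_sub_le_of_waterPower_eq (hK' : K'.IsHermitian) {ν ν' : ℝ}
    (h : hK.waterPower ν = hK'.waterPower ν') :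
    frobeniusNorm (hK.waterfill ν - hK'.waterfill ν') ≤ frobeniusNorm (K - K') := by
  have h1 := hK.le_frobeniusInner_add_waterfill ν (hK'.posSemidef_waterfill ν')
  have h2 := hK'.le_frobeniusInner_add_waterfill ν' (hK.posSemidef_waterfill ν)
  rw [trace_waterfill, h, sub_self, mul_zero] at h1
  rw [trace_waterfill, h, sub_self, mul_zero] at h2
  set Y := hK.waterfill ν
  set Y' := hK'.waterfill ν'
  have h3 := frobeniusInner_le (K - K') (Y' - Y)
  have h4 := frobeniusInner_self (Y - Y')
  rw [frobeniusNorm_sub_comm Y' Y] at h3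
  simp only [frobeniusInner_add_left, frobeniusInner_sub_left, frobeniusInner_sub_right] at *
  rw [frobeniusInner_comm Y' Y] at *
  -- Adding the two variational inequalities gives `‖Y - Y'‖² ≤ ⟨K - K', Y' - Y⟩`; Cauchy–Schwarz
  -- and cancellation of one factor finish.
  have h0 := frobeniusNorm_nonneg (Y - Y')
  rcases h0.eq_or_lt with h5 | h5
  · rw [← h5]; exact frobeniusNorm_nonneg _
  · refine le_of_mul_le_mul_right ?_ h5
    nlinarith

variable [Nonempty n]

/-- The smallest eigenvalue. -/
def minEigenvalue : ℝ := Finset.univ.inf' Finset.univ_nonempty hK.eigenvalues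

theorem minEigenvalue_le (i : n) : hK.minEigenvalue ≤ hK.eigenvalues i :=
  Finset.inf'_le _ (Finset.mem_univ i)

theorem exists_eigenvalues_eq_min : ∃ i, hK.eigenvalues i = hK.minEigenvalue := by
  obtain ⟨i, -, hi⟩ := Finset.exists_mem_eq_inf' Finset.univ_nonempty hK.eigenvalues
  exact ⟨i, hi.symm⟩

theorem waterPower_minEigenvalue : hK.waterPower hK.minEigenvalue = 0 :=
  Finset.sum_eq_zero fun i _ => max_eq_right (sub_nonpos.2 (hK.minEigenvalue_le i))

theorem sub_minEigenvalue_le_waterPower (ν : ℝ) :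
    ν - hK.minEigenvalue ≤ hK.waterPower ν := by
  obtain ⟨i, hi⟩ := hK.exists_eigenvalues_eq_min
  rw [← hi]
  exact (le_max_left _ 0).trans (Finset.single_le_sum
    (f := fun i => max (ν - hK.eigenvalues i) 0) (fun _ _ => le_max_right _ _) (Finset.mem_univ i))

/-- The lower bound on the level matters at `p = 0`, where every level below the smallest eigenvalue
would do: it keeps the level positive when `K` is positive definite, so that `ν⁻¹` is a price. -/
theorem exists_waterPower_eq {p : ℝ} (hp : 0 ≤ p) :
    ∃ ν, hK.minEigenvalue ≤ ν ∧ hK.waterPower ν = p := by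
  have hle : hK.minEigenvalue ≤ hK.minEigenvalue + p := by linarith
  have h := intermediate_value_Icc hle hK.continuous_waterPower.continuousOn
  have hmem : p ∈ Set.Icc (hK.waterPower hK.minEigenvalue)
      (hK.waterPower (hK.minEigenvalue + p)) := by
    refine ⟨by rwa [waterPower_minEigenvalue], ?_⟩
    have := hK.sub_minEigenvalue_le_waterPower (hK.minEigenvalue + p)
    linarith
  obtain ⟨ν, hν, h⟩ := h hmem
  exact ⟨ν, hν.1, h⟩

/-- Joint dependence of a water-filling solution on the matrix to be filled and on the power. A
change at fixed power is traceless and a change of power is semidefinite; these two are not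
aligned, which improves on the triangle inequality. -/
theorem frobeniusNorm_waterfill_sub_sq_le (hK' : K'.IsHermitian) {ν ν' a b N : ℝ}
    (ha : frobeniusNorm (K - K') ≤ a) (hb : |hK.waterPower ν - hK'.waterPower ν'| ≤ b)
    (hN : Fintype.card n ≤ N) :
    frobeniusNorm (hK.waterfill ν - hK'.waterfill ν') ^ 2 ≤
      a ^ 2 + 2 * Real.sqrt (1 - 1 / N) * a * b + b ^ 2 := by
  -- The intermediate point fills `K'` with the power used over `K`: `E` changes only the matrix,
  -- `F` only the power.
  obtain ⟨μ, -, hμ⟩ := hK'.exists_waterPower_eq (hK.waterPower_nonneg ν)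
  set E := hK.waterfill ν - hK'.waterfill μ with hE
  set F := hK'.waterfill μ - hK'.waterfill ν' with hF
  set t := F.trace.re with ht
  have hsplit : hK.waterfill ν - hK'.waterfill ν' = E + F := by rw [hE, hF]; abel
  have hE0 : frobeniusNorm E ≤ a :=
    (hK.frobeniusNorm_waterfill_sub_le_of_waterPower_eq hK' hμ.symm).trans ha
  have hEt : E.trace.re = 0 := by
    rw [hE, trace_sub, Complex.sub_re, trace_waterfill, trace_waterfill, hμ, sub_self]
  have htb : |t| ≤ b := by
    rw [ht, hF, trace_sub, Complex.sub_re, trace_waterfill, trace_waterfill, hμ]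
    exact hb
  have hFt : frobeniusNorm F ≤ |t| := by
    have := hK'.frobeniusNorm_waterfill_sub_le μ ν'
    rwa [← trace_waterfill, ← trace_waterfill, ← Complex.sub_re, ← trace_sub] at this
  have hn : (0 : ℝ) < (Fintype.card n : ℝ) := by exact_mod_cast Fintype.card_pos
  set c : ℝ := (Fintype.card n : ℝ) with hc
  -- `T` is the scalar matrix with the trace of `F`. It is orthogonal to the traceless `E`, so only
  -- `F - T` contributes to `⟨E, F⟩`, and `‖F - T‖² = ‖F‖² - t² / c`.
  set T : Matrix n n ℂ := (((t / c : ℝ)) : ℂ) • 1 with hT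
  have hET : frobeniusInner E T = 0 := by
    have hEh : Eᴴ = E := by
      rw [hE, conjTranspose_sub, (hK.posSemidef_waterfill ν).1.eq,
        (hK'.posSemidef_waterfill μ).1.eq]
    rw [frobeniusInner, hEh, hT, Matrix.mul_smul, mul_one, trace_smul, smul_eq_mul,
      Complex.re_ofReal_mul, hEt, mul_zero]
  have hFT : frobeniusInner F T = t ^ 2 / c := by
    have hFh : Fᴴ = F := by
      rw [hF, conjTranspose_sub, (hK'.posSemidef_waterfill μ).1.eq,
        (hK'.posSemidef_waterfill ν').1.eq]
    rw [frobeniusInner, hFh, hT, Matrix.mul_smul, mul_one, trace_smul, smul_eq_mul,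
      Complex.re_ofReal_mul, ← ht]
    ring
  have hTT : frobeniusInner T T = t ^ 2 / c := by
    have h1 : Tᴴ * T = (((t / c : ℝ) ^ 2 : ℝ) : ℂ) • (1 : Matrix n n ℂ) := by
      rw [hT, conjTranspose_smul, conjTranspose_one, Matrix.mul_smul, mul_one, smul_smul]
      congr 1
      simp [sq]
    rw [frobeniusInner, h1, trace_smul, trace_one, smul_eq_mul, Complex.re_ofReal_mul,
      Complex.natCast_re]
    field_simp
    rw [hc]
  have hFTn : frobeniusNorm (F - T) ^ 2 ≤ (1 - 1 / N) * b ^ 2 := by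
    rw [← frobeniusInner_self, frobeniusInner_sub_left, frobeniusInner_sub_right F F T,
      frobeniusInner_sub_right T F T, frobeniusInner_comm T F, hFT, hTT, frobeniusInner_self]
    have h1 : frobeniusNorm F ^ 2 ≤ t ^ 2 := by
      rw [← sq_abs t]
      exact pow_le_pow_left₀ (frobeniusNorm_nonneg _) hFt 2
    have h2 : t ^ 2 ≤ b ^ 2 := by
      rw [← sq_abs t]
      exact pow_le_pow_left₀ (abs_nonneg _) htb 2
    have h3 : 1 / N ≤ 1 / c := one_div_le_one_div_of_le hn hN
    have h4 : 1 / N ≤ 1 := by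
      have : (1 : ℝ) ≤ c := by rw [hc]; exact_mod_cast Fintype.card_pos (α := n)
      exact (div_le_one (hn.trans_le hN)).2 (this.trans hN)
    have h5 : t ^ 2 / c = 1 / c * t ^ 2 := by ring
    rw [h5]
    nlinarith [mul_le_mul_of_nonneg_right h3 (sq_nonneg t)]
  have hb0 : 0 ≤ b := (abs_nonneg _).trans htb
  have hN0 : 0 ≤ 1 - 1 / N := by
    have : (1 : ℝ) ≤ c := by rw [hc]; exact_mod_cast Fintype.card_pos (α := n)
    exact sub_nonneg.2 ((div_le_one (hn.trans_le hN)).2 (this.trans hN))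
  have hFTn' : frobeniusNorm (F - T) ≤ Real.sqrt (1 - 1 / N) * b := by
    refine le_of_sq_le_sq ?_ (by positivity)
    rwa [mul_pow, Real.sq_sqrt hN0]
  have hEF : frobeniusInner E F ≤ a * (Real.sqrt (1 - 1 / N) * b) := by
    have h1 : frobeniusInner E F = frobeniusInner E (F - T) := by
      rw [frobeniusInner_sub_right E F T, hET, sub_zero]
    rw [h1]
    exact (frobeniusInner_le _ _).trans
      (mul_le_mul hE0 hFTn' (frobeniusNorm_nonneg _) ((frobeniusNorm_nonneg _).trans hE0))
  rw [hsplit, frobeniusNorm_add_sq]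
  have h1 := pow_le_pow_left₀ (frobeniusNorm_nonneg _) hE0 2
  have h2 := pow_le_pow_left₀ (frobeniusNorm_nonneg _) (hFt.trans htb) 2
  linarith

end IsHermitian

end Matrix

/-! ### Maximization of the energy efficiency. -/

namespace Matrix.PosDef

variable {n : Type*} [Fintype n] [DecidableEq n] {K : Matrix n n ℂ} (hK : K.PosDef)
include hK

theorem posDef_add_waterfill (ν : ℝ) : (K + hK.1.waterfill ν).PosDef :=
  hK.add_posSemidef (hK.1.posSemidef_waterfill ν)

theorem inv_add_waterfill (ν : ℝ) :
    (K + hK.1.waterfill ν)⁻¹ = hK.1.cfc fun x => (max ν x)⁻¹ := by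
  refine inv_eq_left_inv ?_
  rw [hK.1.add_waterfill, hK.1.cfc_mul_cfc, ← hK.1.cfc_one_eq]
  refine hK.1.cfc_congr_eigenvalues fun i => ?_
  exact inv_mul_cancel₀ (lt_max_of_lt_right (hK.eigenvalues_pos i)).ne'

theorem logDet_le_logDet_add {Z : Matrix n n ℂ} (hZ : Z.PosSemidef) :
    logDet K ≤ logDet (K + Z) ∧ (logDet K = logDet (K + Z) → Z = 0) := by
  have hA : (K + Z).PosDef := hK.add_posSemidef hZ
  obtain ⟨h1, h2⟩ := hA.logDet_le hK
  have htr : ((K + Z)⁻¹ * K).trace.re - Fintype.card n ≤ 0 := by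
    have e1 : (K + Z)⁻¹ * K = 1 - (K + Z)⁻¹ * Z := by
      rw [eq_sub_iff_add_eq, ← Matrix.mul_add]
      exact nonsing_inv_mul _ ((isUnit_iff_isUnit_det _).1 hA.isUnit)
    have e2 := hA.inv.posSemidef.trace_mul_re_nonneg hZ
    rw [e1, trace_sub, trace_one, Complex.sub_re, Complex.natCast_re]
    linarith
  refine ⟨by linarith, fun h => ?_⟩
  simpa using h2 (by linarith)

/-- At price `ν⁻¹` per unit of power, the water-filling solution with water level `ν` is the unique
maximizer of the rate net of the cost of the power. -/
theorem logDet_add_le_waterfill {ν : ℝ} (hν : 0 < ν) {Z : Matrix n n ℂ} (hZ : Z.PosSemidef) :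
    logDet (K + Z) ≤
        logDet (K + hK.1.waterfill ν) + ν⁻¹ * (Z.trace.re - hK.1.waterPower ν) ∧
      (logDet (K + Z) =
          logDet (K + hK.1.waterfill ν) + ν⁻¹ * (Z.trace.re - hK.1.waterPower ν) →
        Z = hK.1.waterfill ν) := by
  obtain ⟨h1, h2⟩ := (hK.posDef_add_waterfill ν).logDet_le (hK.add_posSemidef hZ)
  have hA := hK.posDef_add_waterfill ν
  have htr : ((K + hK.1.waterfill ν)⁻¹ * (K + Z)).trace.re - Fintype.card n ≤
      ν⁻¹ * (Z.trace.re - hK.1.waterPower ν) := by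
    have e1 : K + Z = (K + hK.1.waterfill ν) + (Z - hK.1.waterfill ν) := by abel
    have e2 : (K + hK.1.waterfill ν)⁻¹ * (K + hK.1.waterfill ν) = 1 :=
      nonsing_inv_mul _ ((isUnit_iff_isUnit_det _).1 hA.isUnit)
    have e3 : hK.1.cfc (fun x => (max ν x)⁻¹) * hK.1.waterfill ν =
        hK.1.cfc fun x => ν⁻¹ * max (ν - x) 0 := by
      rw [IsHermitian.waterfill, hK.1.cfc_mul_cfc]
      refine hK.1.cfc_congr_eigenvalues fun i => ?_
      rcases le_total ν (hK.1.eigenvalues i) with h | h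
      · rw [max_eq_right (sub_nonpos.2 h), mul_zero, mul_zero]
      · rw [max_eq_left h]
    have e4 : 0 ≤ (hK.1.cfc (fun x => ν⁻¹ * 1 - (max ν x)⁻¹) * Z).trace.re := by
      refine PosSemidef.trace_mul_re_nonneg
        (hK.1.posSemidef_cfc (f := fun x => ν⁻¹ * 1 - (max ν x)⁻¹) fun i => ?_) hZ
      rw [mul_one]
      exact sub_nonneg.2 (inv_anti₀ hν (le_max_left _ _))
    have e5 : hK.1.cfc (fun _ => ν⁻¹ * 1) = ((ν⁻¹ : ℝ) : ℂ) • (1 : Matrix n n ℂ) := by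
      have h1 : diagonal (RCLike.ofReal ∘ (fun _ : ℝ => ν⁻¹ * 1) ∘ hK.1.eigenvalues) =
          (((ν⁻¹ : ℝ) : ℂ) • 1 : Matrix n n ℂ) := by
        rw [← diagonal_one, ← diagonal_smul]; congr 1; ext i; simp
      rw [IsHermitian.cfc, h1, map_smul, map_one]
    rw [← hK.1.cfc_sub_cfc, e5, Matrix.sub_mul, trace_sub, Complex.sub_re, Matrix.smul_mul,
      Matrix.one_mul, trace_smul, smul_eq_mul, Complex.re_ofReal_mul] at e4
    rw [e1, Matrix.mul_add, e2, inv_add_waterfill hK, Matrix.mul_sub, e3, trace_add, trace_sub,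
      trace_one, Complex.add_re, Complex.sub_re, hK.1.trace_cfc, Complex.natCast_re,
      ← Finset.mul_sum]
    have : ∑ i, max (ν - hK.1.eigenvalues i) 0 = hK.1.waterPower ν := rfl
    rw [this, mul_sub]
    linarith
  refine ⟨by linarith, fun h => ?_⟩
  have := h2 (by linarith)
  exact add_left_cancel this

theorem logDet_add_waterfill (ν : ℝ) :
    logDet (K + hK.1.waterfill ν) = ∑ i, Real.log (max ν (hK.1.eigenvalues i)) := by
  rw [logDet, hK.1.add_waterfill, hK.1.det_cfc,
    Real.log_prod fun i _ => (lt_max_of_lt_right (hK.eigenvalues_pos i)).ne']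

variable [Nonempty n]

theorem minEigenvalue_pos : 0 < hK.1.minEigenvalue := by
  obtain ⟨i, hi⟩ := hK.1.exists_eigenvalues_eq_min
  exact hi ▸ hK.eigenvalues_pos i

/-- The equation says that the efficiency of the water-filling solution equals its own price `ν⁻¹`.
At the smallest eigenvalue the rate is zero and the cost positive; for large levels the rate grows
logarithmically while the cost stays bounded. The intermediate value theorem applies. -/
theorem exists_stationary_level {Ψ : ℝ} (hΨ : 0 < Ψ) :
    ∃ ν, hK.1.minEigenvalue < ν ∧
      logDet (K + hK.1.waterfill ν) - logDet K = ν⁻¹ * (Ψ + hK.1.waterPower ν) := by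
  set κ := hK.1.minEigenvalue with hκ
  have hκ0 : 0 < κ := hK.minEigenvalue_pos
  set c : ℝ := (Fintype.card n : ℝ)
  set g : ℝ → ℝ := fun ν => (∑ i, Real.log (max ν (hK.1.eigenvalues i))) - logDet K -
    ν⁻¹ * (Ψ + hK.1.waterPower ν) with hg
  -- Chosen so that the smallest eigenvalue alone contributes `Ψ / κ + c` to the rate, which bounds
  -- the cost at every level above `κ`.
  set R := κ * Real.exp (Ψ / κ + c) with hR
  have hκR : κ ≤ R := by
    rw [hR]
    have : 1 ≤ Real.exp (Ψ / κ + c) := Real.one_le_exp (by positivity)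
    nlinarith
  have hcont : ContinuousOn g (Set.Icc κ R) := by
    refine ContinuousOn.sub (ContinuousOn.sub ?_ continuousOn_const) (ContinuousOn.mul ?_ ?_)
    · refine continuousOn_finsetSum _ fun i _ => ?_
      refine ContinuousOn.log (by fun_prop) fun ν _ => ?_
      exact (lt_max_of_lt_right (hK.eigenvalues_pos i)).ne'
    · exact continuousOn_inv₀.mono fun ν hν => (hκ0.trans_le hν.1).ne'
    · exact (continuous_const.add hK.1.continuous_waterPower).continuousOn
  have hlow : g κ < 0 := by
    have h1 : ∑ i, Real.log (max κ (hK.1.eigenvalues i)) = logDet K := by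
      rw [hK.logDet_eq_sum]
      exact Finset.sum_congr rfl fun i _ => by rw [max_eq_right (hK.1.minEigenvalue_le i)]
    simp only [hg, hκ, hK.1.waterPower_minEigenvalue, add_zero]
    have : 0 < hK.1.minEigenvalue⁻¹ * Ψ := mul_pos (inv_pos.2 hκ0) hΨ
    linarith
  have hhigh : 0 ≤ g R := by
    have hR0 : 0 < R := hκ0.trans_le hκR
    obtain ⟨i₀, hi₀⟩ := hK.1.exists_eigenvalues_eq_min
    have h1 : Ψ / κ + c ≤ (∑ i, Real.log (max R (hK.1.eigenvalues i))) - logDet K := by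
      rw [hK.logDet_eq_sum, ← Finset.sum_sub_distrib]
      have h2 : Ψ / κ + c = Real.log (max R (hK.1.eigenvalues i₀)) -
          Real.log (hK.1.eigenvalues i₀) := by
        rw [hi₀, ← hκ, max_eq_left hκR, hR, Real.log_mul hκ0.ne' (Real.exp_pos _).ne',
          Real.log_exp]
        ring
      rw [h2]
      refine Finset.single_le_sum (f := fun i => Real.log (max R (hK.1.eigenvalues i)) -
          Real.log (hK.1.eigenvalues i)) (fun i _ => ?_) (Finset.mem_univ i₀)
      exact sub_nonneg.2 (Real.log_le_log (hK.eigenvalues_pos i) (le_max_right _ _))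
    have h3 : hK.1.waterPower R ≤ c * R := by
      have : ∀ i ∈ Finset.univ, max (R - hK.1.eigenvalues i) 0 ≤ R := fun i _ =>
        max_le (by linarith [hK.eigenvalues_pos i]) hR0.le
      calc hK.1.waterPower R ≤ ∑ _i : n, R := Finset.sum_le_sum this
        _ = c * R := by simp [c]
    have h4 : R⁻¹ * (Ψ + hK.1.waterPower R) ≤ Ψ / κ + c := by
      calc R⁻¹ * (Ψ + hK.1.waterPower R) ≤ R⁻¹ * (Ψ + c * R) := by gcongr
        _ = Ψ / R + c := by field_simp
        _ ≤ Ψ / κ + c := by gcongr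
    simp only [hg]
    linarith
  obtain ⟨ν, hν, h⟩ := intermediate_value_Icc hκR hcont ⟨hlow.le, hhigh⟩
  refine ⟨ν, lt_of_le_of_ne hν.1 ?_, ?_⟩
  · rintro rfl
    exact hlow.ne h
  · rw [hK.logDet_add_waterfill]
    simp only [hg] at h
    linarith

omit hK [Nonempty n] in
/-- The ratio of the rate to the consumed power, for the effective noise covariance `K`. -/
def _root_.Matrix.efficiency (K : Matrix n n ℂ) (Ψ : ℝ) (Y : Matrix n n ℂ) : ℝ :=
  (logDet (K + Y) - logDet K) / (Ψ + Y.trace.re)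

/-- Maximizers of the energy efficiency: there is a unique one without a bound on the power, its
power is positive, and, for every bound on the power, the unique maximizer under this bound is a
water-filling solution whose power is the smaller one of the bound and the unconstrained optimal
power. -/
theorem exists_efficiency_maximizer {Ψ : ℝ} (hΨ : 0 < Ψ) :
    ∃ Y₀ : Matrix n n ℂ, Y₀.PosSemidef ∧ 0 < Y₀.trace.re ∧
      (∀ Z : Matrix n n ℂ, Z.PosSemidef → efficiency K Ψ Z ≤ efficiency K Ψ Y₀ ∧
        (efficiency K Ψ Z = efficiency K Ψ Y₀ → Z = Y₀)) ∧
      ∀ P, 0 ≤ P → ∃ ν, hK.1.waterPower ν = min P Y₀.trace.re ∧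
        ∀ Z : Matrix n n ℂ, Z.PosSemidef → Z.trace.re ≤ P →
          efficiency K Ψ Z ≤ efficiency K Ψ (hK.1.waterfill ν) ∧
          (efficiency K Ψ Z = efficiency K Ψ (hK.1.waterfill ν) → Z = hK.1.waterfill ν) := by
  obtain ⟨ν₀, hν₀, h₀⟩ := hK.exists_stationary_level hΨ
  have hκ := hK.minEigenvalue_pos
  have hν₀0 : 0 < ν₀ := hκ.trans hν₀
  have htr : ∀ Z : Matrix n n ℂ, Z.PosSemidef → 0 ≤ Z.trace.re := fun Z hZ =>
    (Complex.nonneg_iff.1 hZ.trace_nonneg).1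
  have hE₀ : efficiency K Ψ (hK.1.waterfill ν₀) = ν₀⁻¹ := by
    have := hK.1.waterPower_nonneg ν₀
    rw [efficiency, h₀, hK.1.trace_waterfill, mul_div_assoc, div_self (by linarith), mul_one]
  have hglob : ∀ Z : Matrix n n ℂ, Z.PosSemidef →
      efficiency K Ψ Z ≤ efficiency K Ψ (hK.1.waterfill ν₀) ∧
      (efficiency K Ψ Z = efficiency K Ψ (hK.1.waterfill ν₀) → Z = hK.1.waterfill ν₀) := by
    intro Z hZ
    obtain ⟨h1, h2⟩ := hK.logDet_add_le_waterfill hν₀0 hZ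
    have hd : 0 < Ψ + Z.trace.re := add_pos_of_pos_of_nonneg hΨ (htr Z hZ)
    rw [hE₀, efficiency]
    refine ⟨(div_le_iff₀ hd).2 (by linarith), fun h => h2 ?_⟩
    rw [div_eq_iff hd.ne'] at h
    linarith
  refine ⟨hK.1.waterfill ν₀, hK.1.posSemidef_waterfill ν₀, ?_, hglob, fun P hP => ?_⟩
  · rw [hK.1.trace_waterfill]
    linarith [hK.1.sub_minEigenvalue_le_waterPower ν₀]
  rw [hK.1.trace_waterfill]
  rcases le_or_gt (hK.1.waterPower ν₀) P with hle | hlt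
  · exact ⟨ν₀, (min_eq_right hle).symm, fun Z hZ _ => hglob Z hZ⟩
  obtain ⟨ν, hν, hνP⟩ := hK.1.exists_waterPower_eq hP
  have hνlt : ν < ν₀ := by
    by_contra! h
    have := hK.1.monotone_waterPower h
    linarith
  have hν0 : 0 < ν := hκ.trans_le hν
  refine ⟨ν, by rw [hνP, min_eq_left hlt.le], fun Z hZ hZP => ?_⟩
  obtain ⟨h1, h2⟩ := hK.logDet_add_le_waterfill hν0 hZ
  rw [hνP] at h1 h2
  set e := efficiency K Ψ (hK.1.waterfill ν) with he
  -- Below the stationary level the price exceeds the efficiency. Since `Z` uses at most the power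
  -- `P`, replacing the price by `e` in the concavity bound only weakens it.
  have hel : e ≤ ν⁻¹ := by
    have h3 := (hglob _ (hK.1.posSemidef_waterfill ν)).1
    rw [hE₀] at h3
    exact h3.trans (inv_anti₀ hν0 hνlt.le)
  have heq : logDet (K + hK.1.waterfill ν) - logDet K = e * (Ψ + P) := by
    rw [he, efficiency, hK.1.trace_waterfill, hνP, div_mul_cancel₀ _ (by linarith)]
  have hd : 0 < Ψ + Z.trace.re := add_pos_of_pos_of_nonneg hΨ (htr Z hZ)
  have hkey : ν⁻¹ * (Z.trace.re - P) ≤ e * (Z.trace.re - P) :=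
    mul_le_mul_of_nonpos_right hel (by linarith)
  rw [efficiency]
  refine ⟨(div_le_iff₀ hd).2 (by nlinarith), fun h => h2 ?_⟩
  rw [div_eq_iff hd.ne'] at h
  refine le_antisymm h1 ?_
  nlinarith

end Matrix.PosDef

/-! ### Weighted maximum norms. -/

section WeightedNorms

variable {ι : Type*} [Finite ι] {n : ι → ℕ} {w : ι → ℝ}

theorem frobeniusNorm_le_mul_weightedBlockMaxNorm (hw : ∀ q, 0 < w q)
    (X : ∀ q, Matrix (Fin (n q)) (Fin (n q)) ℂ) (q : ι) :
    frobeniusNorm (X q) ≤ w q * weightedBlockMaxNorm w X := by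
  rw [← div_le_iff₀' (hw q)]
  exact le_ciSup (f := fun q => frobeniusNorm (X q) / w q) (Set.finite_range _).bddAbove q

theorem abs_le_mul_weightedMaxNorm (hw : ∀ q, 0 < w q) (u : ι → ℝ) (q : ι) :
    |u q| ≤ w q * weightedMaxNorm w u := by
  rw [← div_le_iff₀' (hw q)]
  exact le_ciSup (f := fun q => |u q| / w q) (Set.finite_range _).bddAbove q

omit [Finite ι] in
theorem weightedMaxNorm_nonneg (hw : ∀ q, 0 < w q) (u : ι → ℝ) : 0 ≤ weightedMaxNorm w u :=
  Real.iSup_nonneg fun q => div_nonneg (abs_nonneg _) (hw q).le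

omit [Finite ι] in
theorem weightedBlockMaxNorm_nonneg (hw : ∀ q, 0 < w q)
    (X : ∀ q, Matrix (Fin (n q)) (Fin (n q)) ℂ) : 0 ≤ weightedBlockMaxNorm w X :=
  Real.iSup_nonneg fun q => div_nonneg (frobeniusNorm_nonneg _) (hw q).le

omit [Finite ι] in
theorem weightedBlockMaxNorm_le (hw : ∀ q, 0 < w q)
    {X : ∀ q, Matrix (Fin (n q)) (Fin (n q)) ℂ} {a : ℝ} (ha : 0 ≤ a)
    (h : ∀ q, frobeniusNorm (X q) ≤ w q * a) : weightedBlockMaxNorm w X ≤ a :=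
  Real.iSup_le (fun q => (div_le_iff₀' (hw q)).2 (h q)) ha

theorem eq_of_weightedBlockMaxNorm_sub_le_zero (hw : ∀ q, 0 < w q)
    {X X' : ∀ q, Matrix (Fin (n q)) (Fin (n q)) ℂ} (h : weightedBlockMaxNorm w (X - X') ≤ 0) :
    X = X' := by
  funext q
  have h1 := frobeniusNorm_le_mul_weightedBlockMaxNorm hw (X - X') q
  have h2 := mul_nonpos_of_nonneg_of_nonpos (hw q).le h
  exact sub_eq_zero.1 (frobeniusNorm_eq_zero.1 (le_antisymm (h1.trans h2) (frobeniusNorm_nonneg _)))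

end WeightedNorms

/-! ### Zero forcing and compression to the range of `V`. -/

namespace Matrix

variable {m n : Type*} [Fintype m] [Fintype n] [DecidableEq n] [DecidableEq m]

/-- Noise covariance matrix after zero forcing by the inverse of the channel `H`. -/
def effectiveCov (H R : Matrix n n ℂ) : Matrix n n ℂ := H⁻¹ * R * (H⁻¹)ᴴ

theorem PosDef.effectiveCov {H R : Matrix n n ℂ} (hR : R.PosDef) (hH : IsUnit H) :
    (effectiveCov H R).PosDef :=
  (IsUnit.posDef_star_right_conjugate_iff (isUnit_nonsing_inv_iff.2 hH)).2 hR

/-- With `K` the effective covariance, `K⁻¹ = Hᴴ * R⁻¹ * H`, so the matrix inside the determinant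
factors as `K⁻¹ * (K + Y)`. -/
theorem log_det_one_add_eq {H R Y : Matrix n n ℂ} (hR : R.PosDef) (hH : IsUnit H)
    (hY : Y.PosSemidef) :
    Real.log (det (1 + Hᴴ * R⁻¹ * H * Y)).re =
      logDet (effectiveCov H R + Y) - logDet (effectiveCov H R) := by
  have hK := hR.effectiveCov hH
  have hHd := (isUnit_iff_isUnit_det _).1 hH
  have hinv : (effectiveCov H R)⁻¹ = Hᴴ * R⁻¹ * H := by
    rw [Matrix.effectiveCov, mul_inv_rev, mul_inv_rev, nonsing_inv_nonsing_inv _ hHd,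
      ← conjTranspose_nonsing_inv, nonsing_inv_nonsing_inv _ hHd, mul_assoc]
  have h1 : 1 + Hᴴ * R⁻¹ * H * Y = (effectiveCov H R)⁻¹ * (effectiveCov H R + Y) := by
    rw [mul_add, nonsing_inv_mul _ ((isUnit_iff_isUnit_det _).1 hK.isUnit), hinv]
  have h2 := hK.add_posSemidef hY
  rw [h1, det_mul, ← hK.inv.ofReal_det_re, Complex.re_ofReal_mul,
    Real.log_mul hK.inv.det_re_pos.ne' h2.det_re_pos.ne', det_nonsing_inv, Ring.inverse_eq_inv',
    ← hK.ofReal_det_re, ← Complex.ofReal_inv, Complex.ofReal_re, Real.log_inv]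
  simp only [logDet]
  ring

/-- Sylvester's identity `det (1 + A * B) = det (1 + B * A)` moves `V` across, leaving the
compressed strategy in a square system. -/
theorem log_det_one_add_eq_of_mul_conjTranspose {H : Matrix n m ℂ} {R : Matrix n n ℂ}
    {Y : Matrix m m ℂ} {V : Matrix m n ℂ} (hR : R.PosDef) (hHV : H * V * Vᴴ = H)
    (hH : IsUnit (H * V)) (hY : Y.PosSemidef) :
    Real.log (det (1 + Hᴴ * R⁻¹ * H * Y)).re =
      logDet (effectiveCov (H * V) R + Vᴴ * Y * V) - logDet (effectiveCov (H * V) R) := by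
  rw [← log_det_one_add_eq hR hH (hY.conjTranspose_mul_mul_same V)]
  congr 2
  have h1 : Hᴴ * R⁻¹ * H * Y = V * ((H * V)ᴴ * R⁻¹ * (H * V) * Vᴴ * Y) := by
    conv_lhs => rw [← hHV]
    simp only [conjTranspose_mul, conjTranspose_conjTranspose, Matrix.mul_assoc]
  rw [h1, det_one_add_mul_comm]
  simp only [Matrix.mul_assoc]

/-- Compressing a positive semidefinite matrix to a subspace does not increase its trace, and
leaves it unchanged only if the matrix lives on the subspace. -/
theorem PosSemidef.trace_compress_le {Y : Matrix m m ℂ} {V : Matrix m n ℂ} (hY : Y.PosSemidef)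
    (hV : Vᴴ * V = 1) :
    (Vᴴ * Y * V).trace.re ≤ Y.trace.re ∧
      ((Vᴴ * Y * V).trace.re = Y.trace.re → V * (Vᴴ * Y * V) * Vᴴ = Y) := by
  set Q : Matrix m m ℂ := 1 - V * Vᴴ with hQ
  have hQh : Qᴴ = Q := by simp [hQ]
  have hQQ : Q * Q = Q := by
    have : V * Vᴴ * (V * Vᴴ) = V * Vᴴ := by
      rw [Matrix.mul_assoc, ← Matrix.mul_assoc Vᴴ, hV, Matrix.one_mul]
    simp [hQ, Matrix.mul_sub, Matrix.sub_mul, this]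
  -- The trace lost by compression is the trace of the part of `Y` on the orthogonal complement of
  -- the range of `V`.
  have htr : (Q * Y * Qᴴ).trace = Y.trace - (Vᴴ * Y * V).trace := by
    rw [hQh, trace_mul_cycle, hQQ, hQ, Matrix.sub_mul, Matrix.one_mul, trace_sub,
      trace_mul_cycle Vᴴ Y V, Matrix.mul_assoc]
  have hpsd := hY.mul_mul_conjTranspose_same Q
  have h0 := Complex.nonneg_iff.1 hpsd.trace_nonneg
  rw [htr, Complex.sub_re] at h0
  refine ⟨by linarith [h0.1], fun h => ?_⟩
  have hz : Q * Y * Qᴴ = 0 := by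
    rw [← hpsd.trace_eq_zero_iff, htr]
    refine Complex.ext (by simp [h]) ?_
    exact h0.2.symm
  obtain ⟨C, hC⟩ := hY.exists_eq_conjTranspose_mul_self
  have hCQ : C * Qᴴ = 0 := by
    rw [← conjTranspose_mul_self_eq_zero, conjTranspose_mul, conjTranspose_conjTranspose,
      Matrix.mul_assoc, ← Matrix.mul_assoc Cᴴ, ← hC, ← Matrix.mul_assoc, hz]
  have hYQ : Y * Q = 0 := by rw [← hQh, hC, Matrix.mul_assoc, hCQ, Matrix.mul_zero]
  have hQY : Q * Y = 0 := by
    have := congrArg (fun M => Mᴴ) hYQ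
    rwa [conjTranspose_mul, hQh, hY.1.eq, conjTranspose_zero] at this
  have e1 : Y * (V * Vᴴ) = Y := by
    rw [hQ, Matrix.mul_sub, Matrix.mul_one, sub_eq_zero] at hYQ; exact hYQ.symm
  have e2 : V * Vᴴ * Y = Y := by
    rw [hQ, Matrix.sub_mul, Matrix.one_mul, sub_eq_zero] at hQY; exact hQY.symm
  calc V * (Vᴴ * Y * V) * Vᴴ = V * Vᴴ * (Y * (V * Vᴴ)) := by simp only [Matrix.mul_assoc]
    _ = Y := by rw [e1, e2]

end Matrix

/-! ### Best responses when the direct channels are invertible. -/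

namespace MIMONetwork

variable {ι : Type*} [Fintype ι] [DecidableEq ι]

theorem posDef_interferenceCov {nT nR : ι → ℕ} (N : MIMONetwork nT nR) {X : Profile nT}
    (hX : ∀ r, (X r).PosSemidef) (q : ι) : (N.interferenceCov q X).PosDef :=
  (N.noise_posDef q).add_posSemidef
    (Matrix.posSemidef_sum _ fun r _ => (hX r).mul_mul_conjTranspose_same _)

section Square

variable {n : ι → ℕ} (N : MIMONetwork n n)

/-- Effective noise covariance matrix of user `q`, as seen from its transmitter. -/
def noiseCov (q : ι) (X : Profile n) : Matrix (Fin (n q)) (Fin (n q)) ℂ :=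
  Matrix.effectiveCov (N.H q q) (N.interferenceCov q X)

variable {N} (hH : ∀ q, IsUnit (N.H q q))
include hH

theorem posDef_noiseCov {X : Profile n} (hX : ∀ r, (X r).PosSemidef) (q : ι) :
    (N.noiseCov q X).PosDef :=
  (N.posDef_interferenceCov hX q).effectiveCov (hH q)

theorem energyEfficiency_eq {X : Profile n} (hX : ∀ r, (X r).PosSemidef) (q : ι)
    {Y : Matrix (Fin (n q)) (Fin (n q)) ℂ} (hY : Y.PosSemidef) :
    N.energyEfficiency q Y X = Matrix.efficiency (N.noiseCov q X) (N.Ψ q) Y := by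
  rw [energyEfficiency, rate, Matrix.log_det_one_add_eq (N.posDef_interferenceCov hX q) (hH q) hY]
  rfl

theorem bestResponse_congr {X X' : Profile n} (hX : ∀ r, (X r).PosSemidef)
    (hX' : ∀ r, (X' r).PosSemidef) {q : ι} (h : N.noiseCov q X = N.noiseCov q X') :
    N.bestResponse q X = N.bestResponse q X' := by
  have h1 : ∀ Z ∈ N.strategySet q, N.energyEfficiency q Z X = N.energyEfficiency q Z X' :=
    fun Z hZ => by rw [energyEfficiency_eq hH hX q hZ.1, energyEfficiency_eq hH hX' q hZ.1, h]
  ext Y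
  refine and_congr_right fun hY => forall₂_congr fun Z hZ => ?_
  rw [h1 Y hY, h1 Z hZ]

/-- The unique best response is a water-filling solution, for the power given by the power
mapping. -/
theorem exists_waterfill_bestResponse (hn : ∀ q, 0 < n q) {X : Profile n}
    (hX : ∀ r, (X r).PosSemidef) (q : ι) :
    ∃ ν, (posDef_noiseCov hH hX q).1.waterPower ν = N.optimalPower X q ∧
      ∀ Y, Y ∈ N.bestResponse q X ↔ Y = (posDef_noiseCov hH hX q).1.waterfill ν := by
  have : Nonempty (Fin (n q)) := ⟨⟨0, hn q⟩⟩
  have hK := posDef_noiseCov hH hX q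
  obtain ⟨Y₀, hY₀, -, hmax, hP⟩ := hK.exists_efficiency_maximizer (N.Ψ_pos q)
  have hY₀max : N.IsUnconstrainedMaximizer q X Y₀ := by
    refine ⟨hY₀, fun Z hZ => ?_⟩
    rw [energyEfficiency_eq hH hX q hZ, energyEfficiency_eq hH hX q hY₀]
    exact (hmax Z hZ).1
  -- The unconstrained maximizer is unique, so the choice operator must return `Y₀`.
  have hpow : N.unconstrainedPower q X = Y₀.trace.re := by
    have hsp : N.IsUnconstrainedMaximizer q X
        (Classical.epsilon fun Y => N.IsUnconstrainedMaximizer q X Y) :=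
      Classical.epsilon_spec (p := fun Y => N.IsUnconstrainedMaximizer q X Y) ⟨Y₀, hY₀max⟩
    have h1 := hsp.2 Y₀ hY₀
    rw [energyEfficiency_eq hH hX q hsp.1, energyEfficiency_eq hH hX q hY₀] at h1
    rw [unconstrainedPower, (hmax _ hsp.1).2 (le_antisymm (hmax _ hsp.1).1 h1)]
    rfl
  obtain ⟨ν, hν, hbr⟩ := hP (N.P q) (N.P_nonneg q)
  have hWmem : hK.1.waterfill ν ∈ N.strategySet q := by
    refine ⟨hK.1.posSemidef_waterfill ν, ?_⟩
    rw [power, hK.1.trace_waterfill, hν]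
    exact min_le_left _ _
  refine ⟨ν, by rw [hν, optimalPower, hpow], fun Y => ⟨fun hY => ?_, ?_⟩⟩
  · have h1 := hY.2 _ hWmem
    rw [energyEfficiency_eq hH hX q hWmem.1, energyEfficiency_eq hH hX q hY.1.1] at h1
    have h2 := hbr Y hY.1.1 hY.1.2
    exact h2.2 (le_antisymm h2.1 h1)
  · rintro rfl
    refine ⟨hWmem, fun Z hZ => ?_⟩
    rw [energyEfficiency_eq hH hX q hWmem.1, energyEfficiency_eq hH hX q hZ.1]
    exact (hbr Z hZ.1 hZ.2).1

theorem existsUnique_isBestResponseProfile (hn : ∀ q, 0 < n q) {X : Profile n}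
    (hX : ∀ r, (X r).PosSemidef) : ∃! B, N.IsBestResponseProfile X B := by
  choose ν _ hν using exists_waterfill_bestResponse hH hn hX
  exact ⟨fun q => (posDef_noiseCov hH hX q).1.waterfill (ν q), fun q => (hν q _).2 rfl,
    fun B hB => funext fun q => (hν q _).1 (hB q)⟩

omit hH in
theorem noiseCov_sub (q : ι) (X X' : Profile n) :
    N.noiseCov q X - N.noiseCov q X' = ∑ r ∈ Finset.univ.erase q,
      ((N.H q q)⁻¹ * N.H q r) * (X r - X' r) * ((N.H q q)⁻¹ * N.H q r)ᴴ := by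
  simp only [noiseCov, Matrix.effectiveCov, interferenceCov]
  rw [← sub_mul, ← mul_sub, add_sub_add_left_eq_sub, ← Finset.sum_sub_distrib, Finset.mul_sum,
    Finset.sum_mul]
  refine Finset.sum_congr rfl fun r _ => ?_
  simp only [Matrix.mul_sub, Matrix.sub_mul, Matrix.conjTranspose_mul, Matrix.mul_assoc]

omit hH in
theorem frobeniusNorm_noiseCov_sub_le {w : ι → ℝ}
    (hw : IsRightPerronEigenvector N.interferenceMatrix w) (q : ι) (X X' : Profile n) :
    frobeniusNorm (N.noiseCov q X - N.noiseCov q X') ≤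
      realSpectralRadius N.interferenceMatrix * (w q * weightedBlockMaxNorm w (X - X')) := by
  set d := weightedBlockMaxNorm w (X - X')
  have h1 : ∀ r ∈ Finset.univ.erase q, frobeniusNorm (((N.H q q)⁻¹ * N.H q r) * (X r - X' r) *
      ((N.H q q)⁻¹ * N.H q r)ᴴ) ≤ N.interferenceMatrix q r * w r * d := fun r hr => by
    refine (frobeniusNorm_conj_le_maxSingularValue _ _).trans ?_
    rw [interferenceMatrix, Matrix.of_apply, if_pos (Finset.ne_of_mem_erase hr), mul_assoc]
    exact mul_le_mul_of_nonneg_left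
      (frobeniusNorm_le_mul_weightedBlockMaxNorm hw.1 (X - X') r) (sq_nonneg _)
  rw [noiseCov_sub]
  refine (frobeniusNorm_sum_le _ _).trans ((Finset.sum_le_sum h1).trans (le_of_eq ?_))
  -- The Perron equation in coordinate `q` turns the weighted row sum into `ρ * w q`; the term `r =
  -- q` may be restored since the diagonal is zero.
  have h2 := congrFun hw.2 q
  rw [Matrix.mulVec, dotProduct, Pi.smul_apply, smul_eq_mul] at h2
  rw [← mul_assoc, ← h2, Finset.sum_mul]
  refine Finset.sum_erase _ ?_
  simp [interferenceMatrix]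

end Square

end MIMONetwork

/-! ### Fixed points and the contraction property. -/

namespace MIMONetwork

variable {ι : Type*}

theorem zero_mem_jointStrategySet {nT nR : ι → ℕ} (N : MIMONetwork nT nR) :
    (0 : Profile nT) ∈ N.jointStrategySet := fun q =>
  ⟨Matrix.PosSemidef.zero, by simpa [power] using N.P_nonneg q⟩

/-- A self-map of a joint strategy set that contracts a weighted block-maximum norm has a fixed
point. -/
theorem exists_fixedPoint_of_contraction {nT nR : ι → ℕ} [Fintype ι] (N : MIMONetwork nT nR) {w : ι → ℝ}
    (hw : ∀ q, 0 < w q) {T : Profile nT → Profile nT}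
    (hT : Set.MapsTo T N.jointStrategySet N.jointStrategySet) {β : ℝ} (hβ0 : 0 ≤ β) (hβ1 : β < 1)
    (hcontr : ∀ X ∈ N.jointStrategySet, ∀ X' ∈ N.jointStrategySet,
      weightedBlockMaxNorm w (T X - T X') ≤ β * weightedBlockMaxNorm w (X - X')) :
    ∃ X ∈ N.jointStrategySet, T X = X := by
  let _ : ∀ q, NormedAddCommGroup (Matrix (Fin (nT q)) (Fin (nT q)) ℂ) :=
    fun q => Matrix.frobeniusNormedAddCommGroup
  let _ : ∀ q, NormedSpace ℝ (Matrix (Fin (nT q)) (Fin (nT q)) ℂ) :=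
    fun q => Matrix.frobeniusNormedSpace
  -- Rescaling the blocks by `w` turns the weighted block norm into the supremum norm of the product
  -- space, where Banach's theorem applies.
  let S : Profile nT → Profile nT := fun Z q => w q • Z q
  let S' : Profile nT → Profile nT := fun Z q => (w q)⁻¹ • Z q
  have hSS' : ∀ Z, S (S' Z) = Z := fun Z => funext fun q => smul_inv_smul₀ (hw q).ne' _
  have hnorm : ∀ X X' : Profile nT, ‖S' X - S' X'‖ = weightedBlockMaxNorm w (X - X') := by
    intro X X'
    have hq : ∀ q, ‖(S' X - S' X') q‖ = frobeniusNorm ((X - X') q) / w q := fun q => by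
      rw [Pi.sub_apply, ← smul_sub, norm_smul, Real.norm_of_nonneg (inv_pos.2 (hw q)).le,
        inv_mul_eq_div]
      rfl
    refine le_antisymm ?_ ?_
    · refine (pi_norm_le_iff_of_nonneg (weightedBlockMaxNorm_nonneg hw _)).2 fun q => ?_
      rw [hq q, div_le_iff₀' (hw q)]
      exact frobeniusNorm_le_mul_weightedBlockMaxNorm hw _ q
    · refine weightedBlockMaxNorm_le hw (norm_nonneg _) fun q => ?_
      rw [← div_le_iff₀' (hw q), ← hq q]
      exact norm_le_pi_norm _ q
  have hS'S : ∀ Z, S' (S Z) = Z := fun Z => funext fun q => inv_smul_smul₀ (hw q).ne' _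
  let s : Set (Profile nT) := S ⁻¹' N.jointStrategySet
  have hclosed : IsClosed s := by
    have hent : ∀ q i j, Continuous fun Z : Profile nT => S Z q i j := fun q i j =>
      LinearMap.continuous_of_finiteDimensional (𝕜 := ℝ) (E := Profile nT) (F' := ℂ)
        { toFun := fun Z => S Z q i j
          map_add' := fun Z Z' => by simp [S]
          map_smul' := fun a Z => by simp [S, mul_left_comm] }
    have hs : s = {Z | ∀ q, ((∀ i j, star (S Z q j i) = S Z q i j) ∧
        ∀ x : Fin (nT q) → ℂ, 0 ≤ ∑ i, star (x i) * ∑ j, S Z q i j * x j) ∧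
          (∑ i, S Z q i i).re ≤ N.P q} := by
      ext Z
      refine forall_congr' fun q => and_congr ?_ Iff.rfl
      rw [Matrix.posSemidef_iff_dotProduct_mulVec]
      exact and_congr Matrix.IsHermitian.ext_iff Iff.rfl
    rw [hs]
    simp only [Set.ofPred_forall, Set.ofPred_and]
    refine isClosed_iInter fun q => IsClosed.inter (IsClosed.inter ?_ ?_) ?_
    · exact isClosed_iInter fun i => isClosed_iInter fun j =>
        isClosed_eq (hent q j i).star (hent q i j)
    · refine isClosed_iInter fun x => isClosed_le continuous_const ?_
      exact continuous_finsetSum _ fun i _ => continuous_const.mul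
        (continuous_finsetSum _ fun j _ => (hent q i j).mul continuous_const)
    · exact isClosed_le (Complex.continuous_re.comp (continuous_finsetSum _ fun i _ => hent q i i))
        continuous_const
  have hmaps : Set.MapsTo (fun Z => S' (T (S Z))) s s := fun Z hZ => by
    change S (S' (T (S Z))) ∈ N.jointStrategySet
    rw [hSS']
    exact hT hZ
  have hLip : ContractingWith ⟨β, hβ0⟩ (hmaps.restrict (fun Z => S' (T (S Z))) s s) := by
    refine ⟨by exact_mod_cast hβ1, LipschitzWith.of_dist_le_mul fun Z Z' => ?_⟩
    rw [Subtype.dist_eq, Subtype.dist_eq, dist_eq_norm, dist_eq_norm]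
    change ‖S' (T (S Z)) - S' (T (S Z'))‖ ≤ β * _
    rw [hnorm]
    refine (hcontr _ Z.2 _ Z'.2).trans (le_of_eq ?_)
    rw [← hnorm, hS'S, hS'S]
  have h0 : (0 : Profile nT) ∈ s := by
    have : S 0 = 0 := funext fun q => smul_zero _
    change S 0 ∈ N.jointStrategySet
    rw [this]
    exact N.zero_mem_jointStrategySet
  have : CompleteSpace (Profile nT) := FiniteDimensional.complete ℝ _
  obtain ⟨Z, hZ, hfix, -⟩ := hLip.exists_fixedPoint' hclosed.isComplete hmaps h0 (edist_ne_top _ _)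
  refine ⟨S Z, hZ, ?_⟩
  have h1 : S' (T (S Z)) = Z := hfix
  conv_rhs => rw [← h1, hSS']

variable [Fintype ι] [DecidableEq ι]

section Square

variable {n : ι → ℕ} {N : MIMONetwork n n}

theorem bestResponse_contraction (hH : ∀ q, IsUnit (N.H q q)) (hn : ∀ q, 0 < n q) {w : ι → ℝ}
    (hw : IsRightPerronEigenvector N.interferenceMatrix w)
    (hpower : ∀ X ∈ N.jointStrategySet, ∀ X' ∈ N.jointStrategySet, X ≠ X' →
      weightedMaxNorm w (N.optimalPower X - N.optimalPower X') <
        (1 - realSpectralRadius N.interferenceMatrix) * weightedBlockMaxNorm w (X - X')) :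
    ∃ β : ℝ, 0 ≤ β ∧ β < 1 ∧
      ∀ X ∈ N.jointStrategySet, ∀ X' ∈ N.jointStrategySet,
        ∀ B B', N.IsBestResponseProfile X B → N.IsBestResponseProfile X' B' →
          weightedBlockMaxNorm w (B - B') ≤ β * weightedBlockMaxNorm w (X - X') := by
  set ρ := realSpectralRadius N.interferenceMatrix with hρ
  have hρ0 : 0 ≤ ρ := ENNReal.toReal_nonneg
  have hzero : ∀ X ∈ N.jointStrategySet, ∀ X' ∈ N.jointStrategySet,
      (∀ q, N.noiseCov q X = N.noiseCov q X') → ∀ B B', N.IsBestResponseProfile X B →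
        N.IsBestResponseProfile X' B' → weightedBlockMaxNorm w (B - B') ≤ 0 := by
    intro X hX X' hX' h B B' hB hB'
    have hBB : B = B' := by
      refine (existsUnique_isBestResponseProfile hH hn fun r => (hX r).1).unique hB fun q => ?_
      rw [bestResponse_congr hH (fun r => (hX r).1) (fun r => (hX' r).1) (h q)]
      exact hB' q
    refine weightedBlockMaxNorm_le hw.1 le_rfl fun q => ?_
    simp [hBB, frobeniusNorm_zero]
  -- With a single profile the power hypothesis is vacuous and does not force `ρ < 1`.
  by_cases hsub : ∀ X ∈ N.jointStrategySet, ∀ X' ∈ N.jointStrategySet, X = X'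
  · refine ⟨0, le_rfl, one_pos, fun X hX X' hX' B B' hB hB' => ?_⟩
    rw [zero_mul]
    exact hzero X hX X' hX' (fun q => by rw [hsub X hX X' hX']) B B' hB hB'
  push Not at hsub
  obtain ⟨X₁, hX₁, X₂, hX₂, hne⟩ := hsub
  have hρ1 : ρ < 1 := by
    by_contra! h
    have h1 := weightedMaxNorm_nonneg hw.1 (N.optimalPower X₁ - N.optimalPower X₂)
    have h2 := mul_nonpos_of_nonpos_of_nonneg (sub_nonpos.2 h)
      (weightedBlockMaxNorm_nonneg hw.1 (X₁ - X₂))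
    exact absurd (hpower X₁ hX₁ X₂ hX₂ hne) (not_lt.2 (h2.trans h1))
  -- At `ρ = 0` the cross term vanishes and the angle yields no gain, but then the effective noise
  -- does not depend on the profile.
  rcases hρ0.eq_or_lt with hρz | hρpos
  · refine ⟨0, le_rfl, one_pos, fun X hX X' hX' B B' hB hB' => ?_⟩
    rw [zero_mul]
    refine hzero X hX X' hX' (fun q => ?_) B B' hB hB'
    have h := frobeniusNorm_noiseCov_sub_le hw q X X'
    rw [← hρ, ← hρz, zero_mul] at h
    exact sub_eq_zero.1 (frobeniusNorm_eq_zero.1 (le_antisymm h (frobeniusNorm_nonneg _)))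
  have hι : Nonempty ι := by
    by_contra h
    rw [not_nonempty_iff] at h
    exact hne (Subsingleton.elim _ _)
  -- The total dimension bounds every block size, so one cosine `c < 1` serves all users.
  set M : ℝ := ∑ q, (n q : ℝ) with hM
  have hM0 : 0 < M := Finset.sum_pos (fun q _ => Nat.cast_pos.2 (hn q)) Finset.univ_nonempty
  set c := Real.sqrt (1 - 1 / M) with hc
  have hc0 : 0 ≤ c := Real.sqrt_nonneg _
  have hc1 : c < 1 := by
    rw [hc, Real.sqrt_lt' one_pos]
    have := one_div_pos.2 hM0
    linarith
  set b := ρ ^ 2 + 2 * c * ρ * (1 - ρ) + (1 - ρ) ^ 2 with hb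
  have hρ1' : 0 < 1 - ρ := sub_pos.2 hρ1
  have hb0 : 0 ≤ b := by positivity
  have hb1 : b < 1 := by
    have h := mul_pos (sub_pos.2 hc1) (mul_pos hρpos hρ1')
    -- Since `ρ + (1 - ρ) = 1`, the case `c = 1` would give exactly `b = 1`.
    have : b = 1 - 2 * ((1 - c) * (ρ * (1 - ρ))) := by rw [hb]; ring
    linarith
  refine ⟨Real.sqrt b, Real.sqrt_nonneg _, by rwa [Real.sqrt_lt' one_pos, one_pow],
    fun X hX X' hX' B B' hB hB' => ?_⟩
  set d := weightedBlockMaxNorm w (X - X') with hd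
  have hd0 : 0 ≤ d := weightedBlockMaxNorm_nonneg hw.1 _
  refine weightedBlockMaxNorm_le hw.1 (by positivity) fun q => ?_
  have hq : Nonempty (Fin (n q)) := ⟨⟨0, hn q⟩⟩
  obtain ⟨ν, hν, hBν⟩ := exists_waterfill_bestResponse hH hn (fun r => (hX r).1) q
  obtain ⟨ν', hν', hBν'⟩ := exists_waterfill_bestResponse hH hn (fun r => (hX' r).1) q
  have hpow : weightedMaxNorm w (N.optimalPower X - N.optimalPower X') ≤ (1 - ρ) * d := by
    rcases eq_or_ne X X' with rfl | hXX
    · rw [sub_self]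
      refine le_trans (Real.iSup_le (fun q => ?_) le_rfl) (mul_nonneg hρ1'.le hd0)
      simp
    · exact (hpower X hX X' hX' hXX).le
  have hpq : |(posDef_noiseCov hH (fun r => (hX r).1) q).1.waterPower ν -
      (posDef_noiseCov hH (fun r => (hX' r).1) q).1.waterPower ν'| ≤ (1 - ρ) * (w q * d) := by
    rw [hν, hν']
    refine (abs_le_mul_weightedMaxNorm hw.1 (N.optimalPower X - N.optimalPower X') q).trans ?_
    refine (mul_le_mul_of_nonneg_left hpow (hw.1 q).le).trans (le_of_eq (by ring))
  have hcard : ((Fintype.card (Fin (n q)) : ℕ) : ℝ) ≤ M := by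
    rw [Fintype.card_fin]
    exact Finset.single_le_sum (f := fun q => (n q : ℝ)) (fun q _ => Nat.cast_nonneg _)
      (Finset.mem_univ q)
  have hmain := Matrix.IsHermitian.frobeniusNorm_waterfill_sub_sq_le
    (posDef_noiseCov hH (fun r => (hX r).1) q).1 (posDef_noiseCov hH (fun r => (hX' r).1) q).1
    (frobeniusNorm_noiseCov_sub_le hw q X X') hpq hcard
  rw [Pi.sub_apply, (hBν _).1 (hB q), (hBν' _).1 (hB' q)]
  refine le_of_sq_le_sq (hmain.trans (le_of_eq ?_))
    (mul_nonneg (hw.1 q).le (mul_nonneg (Real.sqrt_nonneg _) hd0))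
  have hsq : (w q * (Real.sqrt b * d)) ^ 2 = b * (w q * d) ^ 2 := by
    rw [mul_left_comm, mul_pow, Real.sq_sqrt hb0]
  rw [hsq, hb, ← hd, ← hc, ← hρ]
  ring

end Square

end MIMONetwork

/-! ### Nash equilibria of the reduced and of the original game. -/

theorem IsCompactSVD.mul_mul_conjTranspose {m n k : ℕ} {A : Matrix (Fin m) (Fin n) ℂ}
    {U : Matrix (Fin m) (Fin k) ℂ} {s : Fin k → ℝ} {V : Matrix (Fin n) (Fin k) ℂ}
    (h : IsCompactSVD A U s V) : A * V * Vᴴ = A := by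
  rw [h.eq_mul, Matrix.mul_assoc _ Vᴴ V, h.right_semiunitary, Matrix.mul_one]

namespace MIMONetwork

variable {ι : Type*}

theorem existsUnique_isNashEquilibrium [Fintype ι] [DecidableEq ι] {n : ι → ℕ} {N : MIMONetwork n n}
    (hH : ∀ q, IsUnit (N.H q q)) (hn : ∀ q, 0 < n q) {w : ι → ℝ} (hw : ∀ q, 0 < w q) {β : ℝ}
    (hβ0 : 0 ≤ β) (hβ1 : β < 1)
    (hcontr : ∀ X ∈ N.jointStrategySet, ∀ X' ∈ N.jointStrategySet,
      ∀ B B', N.IsBestResponseProfile X B → N.IsBestResponseProfile X' B' →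
        weightedBlockMaxNorm w (B - B') ≤ β * weightedBlockMaxNorm w (X - X')) :
    ∃! X, N.IsNashEquilibrium X := by
  -- The best-response map is extended to all profiles, with the irrelevant value `0` off the
  -- strategy set.
  have hex : ∀ X : Profile n, ∃ B, X ∈ N.jointStrategySet → N.IsBestResponseProfile X B := by
    intro X
    by_cases hX : X ∈ N.jointStrategySet
    · obtain ⟨B, hB, -⟩ := existsUnique_isBestResponseProfile hH hn fun r => (hX r).1
      exact ⟨B, fun _ => hB⟩
    · exact ⟨0, fun h => absurd h hX⟩
  choose T hT using hex
  obtain ⟨X, hX, hfix⟩ := N.exists_fixedPoint_of_contraction hw (T := T)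
    (fun X hX q => (hT X hX q).1) hβ0 hβ1
    fun X hX X' hX' => hcontr X hX X' hX' _ _ (hT X hX) (hT X' hX')
  have hXN : N.IsNashEquilibrium X := by
    have h := hT X hX
    rwa [hfix] at h
  refine ⟨X, hXN, fun X' hX' => ?_⟩
  have h1 := hcontr X' (fun q => (hX' q).1) X hX X' X hX' hXN
  refine eq_of_weightedBlockMaxNorm_sub_le_zero hw ?_
  nlinarith

section Reduction

variable {nT nR : ι → ℕ} {N : MIMONetwork nT nR} {V : ∀ q, Matrix (Fin (nT q)) (Fin (nR q)) ℂ}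

variable (hV : ∀ q, (V q)ᴴ * V q = 1) (hHV : ∀ q, N.H q q * V q * (V q)ᴴ = N.H q q)
  (hH : ∀ q, IsUnit (N.H q q * V q))

include hV in
theorem compress_expand (q : ι) (Z : Matrix (Fin (nR q)) (Fin (nR q)) ℂ) :
    (V q)ᴴ * (V q * Z * (V q)ᴴ) * V q = Z := by
  calc (V q)ᴴ * (V q * Z * (V q)ᴴ) * V q = ((V q)ᴴ * V q) * Z * ((V q)ᴴ * V q) := by
        simp only [Matrix.mul_assoc]
    _ = Z := by rw [hV, Matrix.one_mul, Matrix.mul_one]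

include hV in
theorem trace_expand (q : ι) (Z : Matrix (Fin (nR q)) (Fin (nR q)) ℂ) :
    (V q * Z * (V q)ᴴ).trace = Z.trace := by
  rw [Matrix.trace_mul_cycle, hV, Matrix.one_mul]

include hV in
theorem expand_mem_strategySet (q : ι) {Z : Matrix (Fin (nR q)) (Fin (nR q)) ℂ}
    (hZ : Z ∈ (N.reduced V).strategySet q) : V q * Z * (V q)ᴴ ∈ N.strategySet q := by
  refine ⟨hZ.1.mul_mul_conjTranspose_same _, ?_⟩
  rw [power, trace_expand hV]
  exact hZ.2

include hV in
theorem compress_mem_strategySet (q : ι) {Y : Matrix (Fin (nT q)) (Fin (nT q)) ℂ}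
    (hY : Y ∈ N.strategySet q) : (V q)ᴴ * Y * V q ∈ (N.reduced V).strategySet q :=
  ⟨hY.1.conjTranspose_mul_mul_same _, (hY.1.trace_compress_le (hV q)).1.trans hY.2⟩

variable [Fintype ι] [DecidableEq ι]

theorem interferenceCov_reduced (N : MIMONetwork nT nR)
    (V : ∀ q, Matrix (Fin (nT q)) (Fin (nR q)) ℂ) (X : Profile nR) (q : ι) :
    (N.reduced V).interferenceCov q X = N.interferenceCov q fun r => V r * X r * (V r)ᴴ := by
  simp only [interferenceCov, reduced, Matrix.conjTranspose_mul, Matrix.mul_assoc]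

-- The rate sees only the compression of `Y`, while the denominator charges its full trace.
include hHV hH in
theorem energyEfficiency_eq_compress {X : Profile nT} (hX : ∀ r, (X r).PosSemidef) (q : ι)
    {Y : Matrix (Fin (nT q)) (Fin (nT q)) ℂ} (hY : Y.PosSemidef) :
    N.energyEfficiency q Y X =
      (Matrix.logDet (Matrix.effectiveCov (N.H q q * V q) (N.interferenceCov q X) +
          (V q)ᴴ * Y * V q) -
        Matrix.logDet (Matrix.effectiveCov (N.H q q * V q) (N.interferenceCov q X))) /
      (N.Ψ q + Y.trace.re) := by
  rw [energyEfficiency, rate, Matrix.log_det_one_add_eq_of_mul_conjTranspose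
    (N.posDef_interferenceCov hX q) (hHV q) (hH q) hY]
  rfl

include hV hHV hH in
theorem energyEfficiency_expand {X : Profile nR} (hX : ∀ r, (X r).PosSemidef) (q : ι)
    {Z : Matrix (Fin (nR q)) (Fin (nR q)) ℂ} (hZ : Z.PosSemidef) :
    N.energyEfficiency q (V q * Z * (V q)ᴴ) (fun r => V r * X r * (V r)ᴴ) =
      (N.reduced V).energyEfficiency q Z X := by
  rw [energyEfficiency_eq_compress hHV hH (fun r => (hX r).mul_mul_conjTranspose_same _) q
      (hZ.mul_mul_conjTranspose_same _), energyEfficiency_eq hH hX q hZ,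
    compress_expand hV, trace_expand hV, Matrix.efficiency, noiseCov, interferenceCov_reduced]
  rfl

include hHV hH hV in
/-- Compressing a strategy to the range of `V q` does not decrease the energy efficiency. -/
theorem energyEfficiency_le_compress {X : Profile nR} (hX : ∀ r, (X r).PosSemidef) (q : ι)
    {Y : Matrix (Fin (nT q)) (Fin (nT q)) ℂ} (hY : Y.PosSemidef) :
    N.energyEfficiency q Y (fun r => V r * X r * (V r)ᴴ) ≤
      (N.reduced V).energyEfficiency q ((V q)ᴴ * Y * V q) X := by
  have hX' : ∀ r, (V r * X r * (V r)ᴴ).PosSemidef := fun r => (hX r).mul_mul_conjTranspose_same _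
  have hYc := hY.conjTranspose_mul_mul_same (V q)
  rw [energyEfficiency_eq_compress hHV hH hX' q hY, energyEfficiency_eq hH hX q hYc,
    Matrix.efficiency, noiseCov, interferenceCov_reduced]
  have hK := (N.posDef_interferenceCov hX' q).effectiveCov (hH q)
  refine div_le_div_of_nonneg_left (sub_nonneg.2 (hK.logDet_le_logDet_add hYc).1)
    (add_pos_of_pos_of_nonneg (N.Ψ_pos q) (Complex.nonneg_iff.1 hYc.trace_nonneg).1) ?_
  exact add_le_add (le_of_eq rfl) (hY.trace_compress_le (hV q)).1

include hHV hH hV in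
/-- Every best response is supported on the range of `V q`. -/
theorem expand_compress_of_mem_bestResponse (hn : ∀ q, 0 < nR q) {X : Profile nT}
    (hX : ∀ r, (X r).PosSemidef) (q : ι) {Y : Matrix (Fin (nT q)) (Fin (nT q)) ℂ}
    (hY : Y ∈ N.bestResponse q X) : V q * ((V q)ᴴ * Y * V q) * (V q)ᴴ = Y := by
  have : Nonempty (Fin (nR q)) := ⟨⟨0, hn q⟩⟩
  have hK := (N.posDef_interferenceCov hX q).effectiveCov (hH q)
  set K := Matrix.effectiveCov (N.H q q * V q) (N.interferenceCov q X) with hKdef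
  obtain ⟨Y₀, -, hY₀pos, -, hP⟩ := hK.exists_efficiency_maximizer (N.Ψ_pos q)
  obtain ⟨ν, hν, hmax⟩ := hP (N.P q) (N.P_nonneg q)
  set B := hK.1.waterfill ν with hB
  have hBpsd : B.PosSemidef := hK.1.posSemidef_waterfill ν
  have hBtr : B.trace.re = min (N.P q) Y₀.trace.re := by rw [hB, hK.1.trace_waterfill, hν]
  obtain ⟨htr, heq⟩ := hY.1.1.trace_compress_le (hV q)
  set C := (V q)ᴴ * Y * V q with hC
  have hCpsd : C.PosSemidef := hY.1.1.conjTranspose_mul_mul_same _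
  have hCtr : 0 ≤ C.trace.re := (Complex.nonneg_iff.1 hCpsd.trace_nonneg).1
  have hYP : Y.trace.re ≤ N.P q := hY.1.2
  obtain ⟨hrate, hrate0⟩ := hK.logDet_le_logDet_add hCpsd
  have hΨ := N.Ψ_pos q
  have hYE : N.energyEfficiency q Y X =
      (Matrix.logDet (K + C) - Matrix.logDet K) / (N.Ψ q + Y.trace.re) :=
    energyEfficiency_eq_compress hHV hH hX q hY.1.1
  have h1 : Matrix.efficiency K (N.Ψ q) B ≤ N.energyEfficiency q Y X := by
    have hmem : V q * B * (V q)ᴴ ∈ N.strategySet q :=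
      expand_mem_strategySet hV q ⟨hBpsd, hBtr.le.trans (min_le_left _ _)⟩
    have h := hY.2 _ hmem
    rwa [energyEfficiency_eq_compress hHV hH hX q hmem.1, compress_expand hV,
      trace_expand hV] at h
  have h2 : N.energyEfficiency q Y X ≤ Matrix.efficiency K (N.Ψ q) C := by
    rw [hYE, Matrix.efficiency]
    exact div_le_div_of_nonneg_left (sub_nonneg.2 hrate) (by linarith) (by linarith)
  obtain ⟨h3, h4⟩ := hmax C hCpsd (htr.trans hYP)
  have hCB : C = B := h4 (le_antisymm h3 (h1.trans h2))
  have h5 : N.energyEfficiency q Y X = Matrix.efficiency K (N.Ψ q) C :=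
    le_antisymm h2 (h3.trans h1)
  refine heq ?_
  -- A positive rate makes any lost trace strictly costly. A zero rate forces the water-filling
  -- power to vanish; the unconstrained power being positive, the budget is then zero and so is the
  -- trace of `Y`.
  rcases hrate.eq_or_lt with h0 | hpos
  · have hC0 : C = 0 := hrate0 h0
    rw [← hCB, hC0, Matrix.trace_zero, Complex.zero_re] at hBtr
    have hP0 : N.P q ≤ 0 := by
      by_contra! h
      exact (lt_min h hY₀pos).ne hBtr
    linarith
  · rw [hYE, Matrix.efficiency, div_eq_div_iff (by linarith) (by linarith)] at h5
    have := mul_left_cancel₀ (sub_pos.2 hpos).ne' h5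
    linarith

include hHV hH hV in
theorem existsUnique_isNashEquilibrium_of_reduced (hn : ∀ q, 0 < nR q)
    (h : ∃! X, (N.reduced V).IsNashEquilibrium X) : ∃! X, N.IsNashEquilibrium X := by
  obtain ⟨X, hX, huniq⟩ := h
  refine ⟨fun r => V r * X r * (V r)ᴴ, fun q => ⟨expand_mem_strategySet hV q (hX q).1, ?_⟩, ?_⟩
  · intro Z hZ
    have hXpsd : ∀ r, (X r).PosSemidef := fun r => (hX r).1.1
    rw [energyEfficiency_expand hV hHV hH hXpsd q (hX q).1.1]
    exact (energyEfficiency_le_compress hV hHV hH hXpsd q hZ.1).trans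
      ((hX q).2 _ (compress_mem_strategySet hV q hZ))
  · intro X' hX'
    have hpsd : ∀ r, (X' r).PosSemidef := fun r => (hX' r).1.1
    have hexp : X' = fun r => V r * ((V r)ᴴ * X' r * V r) * (V r)ᴴ := funext fun r =>
      (expand_compress_of_mem_bestResponse hV hHV hH hn hpsd r (hX' r)).symm
    have hcpsd : ∀ r, ((V r)ᴴ * X' r * V r).PosSemidef := fun r =>
      (hpsd r).conjTranspose_mul_mul_same _
    have hnash : (N.reduced V).IsNashEquilibrium fun r => (V r)ᴴ * X' r * V r := fun q => by
      refine ⟨compress_mem_strategySet hV q (hX' q).1, fun Z hZ => ?_⟩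
      have h1 := (hX' q).2 _ (expand_mem_strategySet hV q hZ)
      rw [← energyEfficiency_expand hV hHV hH hcpsd q hZ.1,
        ← energyEfficiency_expand hV hHV hH hcpsd q (hcpsd q), ← hexp]
      rwa [← congrFun hexp q]
    have h2 := huniq _ hnash
    rw [hexp]
    funext r
    rw [← congrFun h2 r]

end Reduction

end MIMONetwork

end

/-- The compact singular value decompositions of the direct channels `N.H q q` define the reduced
network `N.reduced V`; its direct channels are square: the ranks are `nR q`. -/
theorem proposition4 {ι : Type*} [Fintype ι] [DecidableEq ι] (nT nR : ι → ℕ)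
    (hnR : ∀ q, 0 < nR q) (N : MIMONetwork nT nR)
    (U : ∀ q, Matrix (Fin (nR q)) (Fin (nR q)) ℂ) (s : ∀ q, Fin (nR q) → ℝ)
    (V : ∀ q, Matrix (Fin (nT q)) (Fin (nR q)) ℂ)
    (hSVD : ∀ q, IsCompactSVD (N.H q q) (U q) (s q) (V q))
    (hns : ∀ q, IsUnit ((N.reduced V).H q q))
    (w : ι → ℝ) (hw : IsRightPerronEigenvector (N.reduced V).interferenceMatrix w)
    (hpower : ∀ X ∈ (N.reduced V).jointStrategySet, ∀ X' ∈ (N.reduced V).jointStrategySet,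
      X ≠ X' →
        weightedMaxNorm w ((N.reduced V).optimalPower X - (N.reduced V).optimalPower X') <
          (1 - realSpectralRadius (N.reduced V).interferenceMatrix) *
            weightedBlockMaxNorm w (X - X')) :
    -- the best-response mapping of the reduced game is well defined
    (∀ X ∈ (N.reduced V).jointStrategySet, ∃! B, (N.reduced V).IsBestResponseProfile X B) ∧
    -- and a contraction
    (∃ β : ℝ, 0 ≤ β ∧ β < 1 ∧
      ∀ X ∈ (N.reduced V).jointStrategySet, ∀ X' ∈ (N.reduced V).jointStrategySet,
        ∀ B B', (N.reduced V).IsBestResponseProfile X B →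
          (N.reduced V).IsBestResponseProfile X' B' →
            weightedBlockMaxNorm w (B - B') ≤ β * weightedBlockMaxNorm w (X - X')) ∧
    -- the game and its reduced form have exactly one Nash equilibrium each
    (∃! X, (N.reduced V).IsNashEquilibrium X) ∧
    (∃! X, N.IsNashEquilibrium X) := by

  have hV := fun q => (hSVD q).right_semiunitary
  have hHV := fun q => (hSVD q).mul_mul_conjTranspose
  obtain ⟨β, hβ0, hβ1, hβ⟩ := MIMONetwork.bestResponse_contraction hns hnR hw hpower
  have hnash := MIMONetwork.existsUnique_isNashEquilibrium hns hnR hw.1 hβ0 hβ1 hβ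
  exact ⟨fun X hX => MIMONetwork.existsUnique_isBestResponseProfile hns hnR fun r => (hX r).1,
    ⟨β, hβ0, hβ1, hβ⟩, hnash,
    MIMONetwork.existsUnique_isNashEquilibrium_of_reduced hV hHV hns hnR hnash⟩
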